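/- For posets $P,Q$, let $P\oplus Q$ be the ordinal sum (every element of $P$ lies below every element of $Q$), let $\mathcal{A}_n$ be the antichain on $n$ elements, and let $c_Q(P)$ be the number of induced subposets of the finite poset $P$ isomorphic to $Q$. Let $M_{n,Q}=\max\{c_Q(P): |P|=n\}$. A poset is layered if it is an ordinal sum of finitely many (possibly zero) finite antichains. For a permutation $r=r_1r_2\ldots r_k\in S_k$ with $k\ge 0$, let $P_r$ be the poset on $\{r_1,\dots,r_k\}$ with $r_i<r_j$ in $P_r$ if and only if $i<j$ and $r_i<r_j$ as integers. Let $l\ge 2$, let $n\ge 0$, and put $Q_l=\mathcal{A}_1\oplus\mathcal{A}_l$. If there is a poset $P$ with $|P|=n$ and $c_{Q_l}(P)=M_{n,Q_l}-1$, then there is a poset $Q$ with $|Q|=n$ and $c_{Q_l}(Q)=M_{n,Q_l}-1$ such that (i) if $l>2$, then $Q$ is layered; (ii) if $l=2$, then $Q\cong Q_1\oplus Q_2$ for some posets $Q_1,Q_2$ with $|Q_1|\le 5$ and $Q_2$ layered (either may be empty); and, in both cases, the same $Q$ also satisfies $Q\cong P_r\oplus\mathcal{A}_m$ for some integer $m$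 with $0\le m\le n$ and some permutation $r\in S_{n-m}$, where $m$ is positive unless $l=2$ and $n=5$. -/

import Mathlib

universe u v w

/-- The antichain `𝒜ₙ` on `n` elements: distinct elements are incomparable. -/
def AntichainPoset (n : ℕ) : Type := Fin n

instance (n : ℕ) : Fintype (AntichainPoset n) := inferInstanceAs (Fintype (Fin n))

instance (n : ℕ) : PartialOrder (AntichainPoset n) where
  le a b := a = b
  le_refl _ := rfl
  le_trans _ _ _ h₁ h₂ := Eq.trans h₁ h₂
  le_antisymm _ _ h _ := h

/-- The poset `P_p` of a permutation `p = p₁ p₂ … pₙ`. The entry `pᵢ` is represented by its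
position `i`; so `i < j` in the poset exactly when `i < j` and `pᵢ < pⱼ` (a noninversion). -/
def PermPoset {n : ℕ} (_p : Equiv.Perm (Fin n)) : Type := Fin n

instance {n : ℕ} (p : Equiv.Perm (Fin n)) : Fintype (PermPoset p) :=
  inferInstanceAs (Fintype (Fin n))

instance {n : ℕ} (p : Equiv.Perm (Fin n)) : PartialOrder (PermPoset p) where
  le := fun (i j : Fin n) => i ≤ j ∧ p i ≤ p j
  le_refl := fun (i : Fin n) => ⟨le_refl i, le_refl (p i)⟩
  le_trans := fun (_ _ _ : Fin n) h₁ h₂ => ⟨h₁.1.trans h₂.1, h₁.2.trans h₂.2⟩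
  le_antisymm := fun (i j : Fin n) h₁ h₂ => (le_antisymm h₁.1 h₂.1 : i = j)

/-- The pattern `Q_l = 𝒜₁ ⊕ 𝒜_l`, where `⊕ₗ` is the ordinal sum of posets. -/
abbrev PatternQ (l : ℕ) : Type := AntichainPoset 1 ⊕ₗ AntichainPoset l

/-- A poset is layered if it is an ordinal sum `𝒜_{p₁} ⊕ ⋯ ⊕ 𝒜_{pₖ}` of antichains
(`Σₗ` is the ordinal sum of a family of posets indexed by a chain). -/
def IsLayered (P : Type u) [PartialOrder P] : Prop :=
  ∃ (k : ℕ) (p : Fin k → ℕ), Nonempty (P ≃o (Σₗ i : Fin k, AntichainPoset (p i)))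

/-- `c_Q(P)`: the number of induced subposets of `P` that are isomorphic to `Q`. -/
noncomputable def copyCount (Q : Type v) [PartialOrder Q] (P : Type u) [PartialOrder P] : ℕ :=
  Set.ncard {S : Set P | Nonempty (S ≃o Q)}

/-- `M_{n,Q}`: the maximum of `c_Q(P)` over all posets `P` with `n` elements. -/
noncomputable def maxCopyCount (n : ℕ) (Q : Type v) [PartialOrder Q] : ℕ :=
  sSup {c : ℕ | ∃ o : PartialOrder (Fin n), c = @copyCount Q _ (Fin n) o}

theorem copyCount_congr (Q : Type v) [PartialOrder Q] {P : Type u} [PartialOrder P]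
    {R : Type w} [PartialOrder R] (e : P ≃o R) : copyCount Q P = copyCount Q R := by
  unfold copyCount
  refine Set.ncard_congr (fun S _ => e '' S) ?_ ?_ ?_
  · rintro S ⟨f⟩
    exact ⟨(RelIso.mk (e.toEquiv.image S) e.le_iff_le : S ≃o (e '' S : Set R)).symm.trans f⟩
  · intro S T _ _ h
    exact e.injective.image_injective h
  · rintro T ⟨f⟩
    refine ⟨e.symm '' T, ⟨(RelIso.mk (e.symm.toEquiv.image T) e.symm.le_iff_le :
      T ≃o (e.symm '' T : Set P)).symm.trans f⟩, ?_⟩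
    exact e.toEquiv.image_symm_image T

/-- The maximum that defines `M_{n,Q}` exists. -/
theorem isGreatest_maxCopyCount (n : ℕ) (Q : Type v) [PartialOrder Q] :
    IsGreatest {c : ℕ | ∃ o : PartialOrder (Fin n), c = @copyCount Q _ (Fin n) o}
      (maxCopyCount n Q) := by
  have hne : {c : ℕ | ∃ o : PartialOrder (Fin n), c = @copyCount Q _ (Fin n) o}.Nonempty :=
    ⟨_, inferInstance, rfl⟩
  have hb : BddAbove {c : ℕ | ∃ o : PartialOrder (Fin n), c = @copyCount Q _ (Fin n) o} := by
    refine ⟨Nat.card (Set (Fin n)), ?_⟩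
    rintro c ⟨o, rfl⟩
    exact Set.ncard_le_card _
  exact ⟨Nat.sSup_mem hne hb, fun c hc => le_csSup hb hc⟩

/-- `M_{n,Q}` bounds `c_Q(P)` for every `n`-poset `P`, whatever its underlying set. -/
theorem copyCount_le_maxCopyCount (Q : Type v) [PartialOrder Q] (P : Type u) [PartialOrder P]
    [Fintype P] : copyCount Q P ≤ maxCopyCount (Fintype.card P) Q := by
  let e : Fin (Fintype.card P) ≃ P := (Fintype.equivFin P).symm
  let o : PartialOrder (Fin (Fintype.card P)) := PartialOrder.lift e e.injective
  have h := @copyCount_congr Q _ _ o P _ (RelIso.mk e Iff.rfl)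
  exact (isGreatest_maxCopyCount (Fintype.card P) Q).2 ⟨o, h.symm⟩

/-! A copy of `𝒜₁ ⊕ 𝒜_l` is a pair (v, A) with A an antichain of size l above v. If S is an ordinal
sum D ⊕ T with T an antichain, then S has c(D) + |D|·C(|T|, l) copies (`IsTop.cnt_eq`). It is
therefore enough to split a top antichain off a poset with M - 1 copies: the bottom is then maximal
or one short of maximal, and induction applies.

The tool is Zykov symmetrization. For incomparable x and y, replace y by a clone of x, or x by a
clone of y. The two new counts sum to twice the old count plus the number of newly created copies
containing both elements (`cnt_clone_add_cnt_clone`). A maximal poset thus creates no such copies, a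
property called `Stable`. A stable poset whose count is positive and at least M - 1 has a top
antichain (`Stable.isTop`), so maxima are attained by layered posets.

If a poset with M - 1 copies is not stable, at most two copies are created and one of the two
clonings gives a maximal poset, which has a top antichain T. Either some poset with M - 1 copies has
a top antichain, or the poset is maximal except for the position of a single element y (`NearTop`).
Then exactly |D|·C(|T| - 1, l - 1) - 1 copies use y. For l ≥ 3 this is impossible, because a
misplaced y destroys too many copies or leaves too many newly created ones
(`NearTop.false_of_three_le`). For l = 2, comparison with rearranged layers leaves only small cases
(`NearTop.outcome_two`): n = 4, where `𝒜₂ ⊕ 𝒜₂` works, and n = 5 with maximum 6, where the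
permutation 15423 gives 5 copies. That one poset is the source of the summand of size at most 5.

Layered posets and permutation posets are both closed under adding an antichain on top, so all the
required forms hold for one poset. -/

namespace PosetPacking

open Finset
open scoped Classical

/-! ### Copies as pairs (v, A) in a finite set with a variable relation -/

section Configurations

variable {α : Type u} {β : Type v}

/-- `A` is an antichain for the strict order `r`, and `v` lies below all of it. -/
def IsCopy (r : α → α → Prop) (v : α) (A : Finset α) : Prop :=
  (∀ a ∈ A, r v a) ∧ ∀ a ∈ A, ∀ b ∈ A, ¬ r a b

/-- The copies `(v, A)` of `𝒜₁ ⊕ 𝒜_l` inside the finset `S`. -/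
noncomputable def copies (r : α → α → Prop) (l : ℕ) (S : Finset α) : Finset (α × Finset α) :=
  {p ∈ S ×ˢ S.powersetCard l | IsCopy r p.1 p.2}

/-- The number of copies of `𝒜₁ ⊕ 𝒜_l` inside the finset `S`. -/
noncomputable def cnt (r : α → α → Prop) (l : ℕ) (S : Finset α) : ℕ := (copies r l S).card

theorem mem_copies {r : α → α → Prop} {l : ℕ} {S : Finset α} {v : α} {A : Finset α} :
    (v, A) ∈ copies r l S ↔ v ∈ S ∧ A ⊆ S ∧ A.card = l ∧ IsCopy r v A := by
  simp [copies, mem_powersetCard, and_assoc]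

theorem copies_mono {r : α → α → Prop} {l : ℕ} {S T : Finset α} (h : S ⊆ T) :
    copies r l S ⊆ copies r l T := by
  rintro ⟨v, A⟩ hp
  rw [mem_copies] at hp ⊢
  exact ⟨h hp.1, hp.2.1.trans h, hp.2.2⟩

theorem copies_congr {r r' : α → α → Prop} {l : ℕ} {S : Finset α}
    (h : ∀ a ∈ S, ∀ b ∈ S, r a b ↔ r' a b) : copies r l S = copies r' l S := by
  ext ⟨v, A⟩
  simp only [mem_copies]
  refine and_congr_right fun hv => and_congr_right fun hA => and_congr_right fun _ => ?_
  refine and_congr ?_ ?_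
  · exact forall₂_congr fun a ha => h v hv a (hA ha)
  · exact forall₂_congr fun a ha => forall₂_congr fun b hb => not_congr (h a (hA ha) b (hA hb))

theorem cnt_congr {r r' : α → α → Prop} {l : ℕ} {S : Finset α}
    (h : ∀ a ∈ S, ∀ b ∈ S, r a b ↔ r' a b) : cnt r l S = cnt r' l S := by
  rw [cnt, copies_congr h, cnt]

theorem cnt_map (r : α → α → Prop) (l : ℕ) (e : β ↪ α) (S : Finset β) :
    cnt (fun a b => r (e a) (e b)) l S = cnt r l (S.map e) := by
  refine card_bij (fun p _ => (e p.1, p.2.map e)) ?_ ?_ ?_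
  · rintro ⟨v, A⟩ hp
    rw [mem_copies] at hp ⊢
    obtain ⟨hv, hA, hc, h1, h2⟩ := hp
    refine ⟨mem_map_of_mem e hv, map_subset_map.2 hA, by simpa using hc, ?_, ?_⟩
    · simpa using h1
    · simpa using h2
  · rintro ⟨v, A⟩ _ ⟨w, B⟩ _ h
    simpa using h
  · rintro ⟨v, A⟩ hp
    rw [mem_copies] at hp
    obtain ⟨hv, hA, hc, h1, h2⟩ := hp
    obtain ⟨w, hw, rfl⟩ := mem_map.1 hv
    obtain ⟨B, hB, rfl⟩ := subset_map_iff.1 hA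
    refine ⟨(w, B), ?_, rfl⟩
    rw [mem_copies]
    refine ⟨hw, hB, by simpa using hc, ?_, ?_⟩
    · simpa using h1
    · simpa using h2

theorem cnt_eq_zero_of_card_le [Std.Irrefl (α := α) r] {l : ℕ} {S : Finset α} (h : S.card ≤ l) :
    cnt r l S = 0 := by
  rw [cnt, card_eq_zero, eq_empty_iff_forall_notMem]
  rintro ⟨v, A⟩ hp
  rw [mem_copies] at hp
  obtain ⟨hv, hA, hc, h1, -⟩ := hp
  have : A = S := eq_of_subset_of_card_le hA (by omega)
  exact irrefl_of r v (h1 v (this ▸ hv))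

end Configurations

/-! ### Induced subposets versus pairs (v, A) -/

section Copies

theorem antichain_not_lt {n : ℕ} (a b : AntichainPoset n) : ¬ a < b :=
  fun h => h.ne (show a = b from h.le)

/-- The vertex set of a copy determines the pair: v is its least element and A is the rest. -/
theorem copyCount_eq_cnt (l : ℕ) (P : Type u) [PartialOrder P] [Fintype P] :
    copyCount (PatternQ l) P = cnt (α := P) (· < ·) l univ := by
  have key : {S : Set P | Nonempty (S ≃o PatternQ l)} =
      (fun p : P × Finset P => (insert p.1 (p.2 : Set P) : Set P)) ''
        (copies (α := P) (· < ·) l univ : Set (P × Finset P)) := by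
    ext S
    constructor
    · rintro ⟨f⟩
      let g : PatternQ l ↪o P := f.symm.toOrderEmbedding.trans (OrderEmbedding.subtype _)
      let i0 : AntichainPoset 1 := (0 : Fin 1)
      let k : AntichainPoset l ↪ P :=
        ⟨fun i => g (Sum.inrₗ i), fun i j h => by simpa using g.injective h⟩
      refine ⟨(g (Sum.inlₗ i0), univ.map k), ?_, ?_⟩
      · rw [mem_coe, mem_copies]
        refine ⟨mem_univ _, subset_univ _, ?_, ?_, ?_⟩
        · rw [card_map]
          exact Fintype.card_fin l
        · intro a ha
          obtain ⟨i, -, rfl⟩ := mem_map.1 ha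
          exact g.lt_iff_lt.2 (Sum.Lex.inl_lt_inr _ _)
        · intro a ha b hb
          obtain ⟨i, -, rfl⟩ := mem_map.1 ha
          obtain ⟨j, -, rfl⟩ := mem_map.1 hb
          intro h
          exact antichain_not_lt i j (Sum.Lex.inr_lt_inr_iff.1 (g.lt_iff_lt.1 h))
      · ext a
        constructor
        · intro ha
          rcases ha with rfl | ha
          · exact (f.symm _).2
          · obtain ⟨i, -, rfl⟩ := mem_map.1 (mem_coe.1 ha)
            exact (f.symm _).2
        · intro ha
          have h : g (f ⟨a, ha⟩) = a := by simp [g]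
          rw [← h]
          rcases f ⟨a, ha⟩ with i | i
          · left
            exact congrArg (fun j : Fin 1 => g (Sum.inlₗ (j : AntichainPoset 1)))
              (Subsingleton.elim _ _)
          · right
            exact mem_coe.2 (mem_map_of_mem k (mem_univ i))
    · rintro ⟨⟨v, A⟩, hp, rfl⟩
      rw [mem_coe, mem_copies] at hp
      obtain ⟨-, -, hc, h1, h2⟩ := hp
      let e := A.equivFinOfCardEq hc
      let g : PatternQ l → P := fun q => Sum.elim (fun _ => v) (fun i : Fin l => (e.symm i : P))
        (ofLex q)
      have hle : ∀ a b, g a ≤ g b ↔ a ≤ b := by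
        rintro (a | a) (b | b)
        · exact ⟨fun _ => Sum.Lex.inl_le_inl_iff.2 (Subsingleton.elim (α := Fin 1) a b),
            fun _ => le_rfl⟩
        · exact ⟨fun _ => Sum.Lex.inl_le_inr _ _, fun _ => (h1 _ (e.symm b).2).le⟩
        · refine ⟨fun h => absurd (h1 _ (e.symm a).2) (not_lt_of_ge h), fun h => ?_⟩
          exact absurd h Sum.Lex.not_inr_le_inl
        · have : ((e.symm a : P) ≤ e.symm b) ↔ a = b := by
            constructor
            · intro h
              rcases h.eq_or_lt with h | h
              · exact e.symm.injective (Subtype.ext h)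
              · exact absurd h (h2 _ (e.symm a).2 _ (e.symm b).2)
            · rintro rfl
              exact le_rfl
          exact this.trans (Sum.Lex.inr_le_inr_iff (α := AntichainPoset 1)
            (β := AntichainPoset l) (a := a) (b := b)).symm
      let G : PatternQ l ↪o P := OrderEmbedding.ofMapLEIff g hle
      have hr : Set.range G = insert v (A : Set P) := by
        ext a
        constructor
        · rintro ⟨i | i, rfl⟩
          · exact Or.inl rfl
          · exact Or.inr (e.symm i).2
        · rintro (rfl | ha)
          · exact ⟨Sum.inlₗ (0 : Fin 1), rfl⟩
          · refine ⟨Sum.inrₗ (e ⟨a, ha⟩), ?_⟩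
            change ((e.symm (e ⟨a, ha⟩) : A) : P) = a
            rw [Equiv.symm_apply_apply]
      change Nonempty ((insert v (A : Set P) : Set P) ≃o PatternQ l)
      rw [← hr]
      exact ⟨G.orderIso.symm⟩
  rw [copyCount, key, Set.InjOn.ncard_image, Set.ncard_coe_finset, cnt]
  rintro ⟨v, A⟩ hA ⟨w, B⟩ hB h
  rw [mem_coe, mem_copies] at hA hB
  obtain ⟨-, -, -, hA, -⟩ := hA
  obtain ⟨-, -, -, hB, -⟩ := hB
  simp only at h
  have hvw : v = w := by
    by_contra hne
    have h1 : v ∈ (insert w (B : Set P) : Set P) := h ▸ Set.mem_insert v _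
    have h2 : w ∈ (insert v (A : Set P) : Set P) := h ▸ Set.mem_insert w _
    exact lt_asymm (hB v (h1.resolve_left hne)) (hA w (h2.resolve_left (Ne.symm hne)))
  subst hvw
  have hvA : v ∉ A := fun h => lt_irrefl _ (hA v h)
  have hvB : v ∉ B := fun h => lt_irrefl _ (hB v h)
  have : insert v A = insert v B := by
    apply Finset.coe_injective
    simpa using h
  rw [← erase_insert hvA, this, erase_insert hvB]

end Copies

/-! ### Attained counts and the maximum -/

section Maximum

variable {α : Type u}

/-- `M_{n,Q}` for `Q = 𝒜₁ ⊕ 𝒜_l`. -/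
noncomputable abbrev M (l n : ℕ) : ℕ := maxCopyCount n (PatternQ l)

/-- Some poset on `n` elements has exactly `c` copies of `𝒜₁ ⊕ 𝒜_l`. -/
def Attained (l n c : ℕ) : Prop :=
  ∃ r : Fin n → Fin n → Prop, IsStrictOrder (Fin n) r ∧ cnt r l univ = c

theorem isStrictOrder_comap {β : Type v} (r : α → α → Prop) [IsStrictOrder α r] (f : β → α) :
    IsStrictOrder β (fun a b => r (f a) (f b)) where
  irrefl a := irrefl_of r (f a)
  trans _ _ _ h h' := trans_of r h h'

theorem attained_cnt (r : α → α → Prop) [IsStrictOrder α r] (l : ℕ) (S : Finset α) :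
    Attained l S.card (cnt r l S) := by
  let e : Fin S.card ↪ α := S.equivFin.symm.toEmbedding.trans (Function.Embedding.subtype _)
  refine ⟨fun a b => r (e a) (e b), isStrictOrder_comap r e, ?_⟩
  rw [cnt_map]
  congr 1
  ext a
  constructor
  · intro h
    obtain ⟨i, -, rfl⟩ := mem_map.1 h
    exact (S.equivFin.symm i).2
  · intro h
    exact mem_map.2 ⟨S.equivFin ⟨a, h⟩, mem_univ _, by simp [e]⟩

theorem Attained.le {l n c : ℕ} (h : Attained l n c) : c ≤ M l n := by
  obtain ⟨r, hr, rfl⟩ := h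
  let o : PartialOrder (Fin n) := partialOrderOfSO r
  exact (isGreatest_maxCopyCount n (PatternQ l)).2 ⟨o, (copyCount_eq_cnt l (Fin n)).symm⟩

theorem attained_max (l n : ℕ) : Attained l n (M l n) := by
  obtain ⟨o, ho⟩ := (isGreatest_maxCopyCount n (PatternQ l)).1
  refine ⟨fun a b => o.lt a b, ?_, ?_⟩
  · exact { irrefl := fun a => lt_irrefl a, trans := fun a b c => lt_trans }
  · rw [M, ho, copyCount_eq_cnt]

theorem cnt_le (r : α → α → Prop) [IsStrictOrder α r] (l : ℕ) (S : Finset α) :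
    cnt r l S ≤ M l S.card := (attained_cnt r l S).le

end Maximum

/-! ### Splitting off a top antichain -/

section Top

variable {α : Type u}

/-- `T` is an antichain and the poset `S` is the ordinal sum of `S \ T` and `T`. -/
def IsTop (r : α → α → Prop) (S T : Finset α) : Prop :=
  T ⊆ S ∧ ∀ t ∈ T, ∀ a ∈ S, r a t ↔ a ∉ T

/-- An antichain that meets T lies inside T, since everything outside T is below T; its bottom v is
then any element outside T. If A misses T, so does v, because nothing outside T lies above an
element of T. -/
theorem IsTop.cnt_eq {r : α → α → Prop} [IsStrictOrder α r] {S T : Finset α} (h : IsTop r S T)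
    {l : ℕ} (hl : 1 ≤ l) :
    cnt r l S = cnt r l (S \ T) + (S \ T).card * T.card.choose l := by
  have hd : Disjoint (copies r l (S \ T)) ((S \ T) ×ˢ T.powersetCard l) := by
    rw [disjoint_left]
    rintro ⟨v, A⟩ h1 h2
    rw [mem_copies] at h1
    rw [mem_product, mem_powersetCard] at h2
    have hA : A.Nonempty := card_pos.1 (by omega)
    obtain ⟨a, ha⟩ := hA
    exact (mem_sdiff.1 (h1.2.1 ha)).2 (h2.2.1 ha)
  rw [cnt, cnt, ← card_powersetCard l T, ← card_product, ← card_union_of_disjoint hd]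
  congr 1
  ext ⟨v, A⟩
  simp only [mem_union, mem_copies, mem_product, mem_powersetCard, mem_sdiff]
  constructor
  · rintro ⟨hv, hA, hc, h1, h2⟩
    obtain ⟨a, ha⟩ : A.Nonempty := card_pos.1 (by omega)
    by_cases hT : ∃ t ∈ A, t ∈ T
    · obtain ⟨t, ht, htT⟩ := hT
      right
      refine ⟨⟨hv, (h.2 t htT v hv).1 (h1 t ht)⟩, fun b hb => ?_, hc⟩
      by_contra hbT
      exact h2 b hb t ht ((h.2 t htT b (hA hb)).2 hbT)
    · push Not at hT
      left
      refine ⟨⟨hv, fun hvT => ?_⟩, fun b hb => mem_sdiff.2 ⟨hA hb, hT b hb⟩, hc, h1, h2⟩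
      exact asymm_of r (h1 a ha) ((h.2 v hvT a (hA ha)).2 (hT a ha))
  · rintro (⟨⟨hv, -⟩, hA, hc, h1⟩ | ⟨⟨hv, hvT⟩, hA, hc⟩)
    · exact ⟨hv, hA.trans sdiff_subset, hc, h1⟩
    · refine ⟨hv, hA.trans h.1, hc, fun a ha => (h.2 a (hA ha) v hv).2 hvT, fun a ha b hb => ?_⟩
      intro hab
      exact (h.2 b (hA hb) a (h.1 (hA ha))).1 hab (hA ha)

theorem Attained.add_top {l a c : ℕ} (h : Attained l a c) (hl : 1 ≤ l) (m : ℕ) :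
    Attained l (a + m) (c + a * m.choose l) := by
  obtain ⟨r, hr, rfl⟩ := h
  let R : Fin a ⊕ Fin m → Fin a ⊕ Fin m → Prop := Sum.Lex r (fun _ _ => False)
  have hR : IsStrictOrder _ R :=
    { irrefl := by
        rintro (i | i) h
        · exact irrefl_of r i (Sum.lex_inl_inl.1 h)
        · exact Sum.lex_inr_inr.1 h
      trans := by
        rintro (i | i) (j | j) (k | k) h h' <;> simp only [R, Sum.lex_inl_inl, Sum.lex_inr_inr,
          Sum.lex_inr_inl, Sum.Lex.sep] at h h' ⊢
        exact trans_of r h h' }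
  have hT : IsTop R univ (univ.map Function.Embedding.inr) := by
    refine ⟨subset_univ _, fun t ht b _ => ?_⟩
    obtain ⟨i, -, rfl⟩ := mem_map.1 ht
    rcases b with b | b <;> simp [R]
  -- Quantifying over the instance lets the rewrite match the classical one in `IsTop.cnt_eq`.
  have hD : ∀ _i : DecidableEq (Fin a ⊕ Fin m), (univ : Finset (Fin a ⊕ Fin m)) \ univ.map Function.Embedding.inr =
      univ.map Function.Embedding.inl := by
    intro _i
    ext (b | b) <;> simp
  have h2 := attained_cnt R l univ
  rw [hT.cnt_eq hl, hD, ← cnt_map] at h2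
  simpa [R] using h2

theorem max_add_le {l : ℕ} (hl : 1 ≤ l) (a m : ℕ) : M l a + a * m.choose l ≤ M l (a + m) :=
  ((attained_max l a).add_top hl m).le

theorem attained_zero (l n : ℕ) (hl : 1 ≤ l) : Attained l n 0 := by
  refine ⟨fun _ _ => False, { irrefl := fun _ h => h, trans := fun _ _ _ h _ => h }, ?_⟩
  rw [cnt, card_eq_zero, eq_empty_iff_forall_notMem]
  rintro ⟨v, A⟩ hp
  rw [mem_copies] at hp
  obtain ⟨a, ha⟩ : A.Nonempty := card_pos.1 (by omega)
  exact hp.2.2.2.1 a ha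

theorem max_eq_zero {l n : ℕ} (h : n ≤ l) : M l n = 0 := by
  obtain ⟨r, hr, hc⟩ := attained_max l n
  rw [← hc]
  exact cnt_eq_zero_of_card_le (by simpa using h)

theorem max_pos {l n : ℕ} (hl : 1 ≤ l) (h : l < n) : 0 < M l n := by
  have := max_add_le hl 1 (n - 1)
  have h2 : 0 < (n - 1).choose l := Nat.choose_pos (by omega)
  rw [show 1 + (n - 1) = n by omega] at this
  omega

end Top

/-! ### Cloning an element -/

section Clone

variable {α : Type u}

/-- The relation in which `y` has been replaced by a clone of `x`. -/
def clone (r : α → α → Prop) (x y : α) : α → α → Prop :=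
  fun a b => r (if a = y then x else a) (if b = y then x else b)

instance (r : α → α → Prop) [IsStrictOrder α r] (x y : α) : IsStrictOrder α (clone r x y) :=
  isStrictOrder_comap r (fun a => if a = y then x else a)

theorem clone_of_ne {r : α → α → Prop} {x y a b : α} (ha : a ≠ y) (hb : b ≠ y) :
    clone r x y a b ↔ r a b := by
  simp [clone, ha, hb]

theorem clone_left {r : α → α → Prop} {x y b : α} (hb : b ≠ y) : clone r x y y b ↔ r x b := by
  simp [clone, hb]

theorem clone_right {r : α → α → Prop} {x y a : α} (ha : a ≠ y) : clone r x y a y ↔ r a x := by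
  simp [clone, ha]

/-- The copies whose antichain contains both `x` and `y`. -/
noncomputable def both (r : α → α → Prop) (l : ℕ) (S : Finset α) (x y : α) :
    Finset (α × Finset α) :=
  {p ∈ copies r l S | x ∈ p.2 ∧ y ∈ p.2}

theorem mem_both {r : α → α → Prop} {l : ℕ} {S : Finset α} {x y v : α} {A : Finset α} :
    (v, A) ∈ both r l S x y ↔ (v, A) ∈ copies r l S ∧ x ∈ A ∧ y ∈ A := by
  simp [both]

theorem both_comm (r : α → α → Prop) (l : ℕ) (S : Finset α) (x y : α) :
    both r l S x y = both r l S y x := by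
  ext ⟨v, A⟩
  rw [mem_both, mem_both, and_comm (a := x ∈ A)]

theorem both_subset_clone {r : α → α → Prop} [IsStrictOrder α r] {l : ℕ} {S : Finset α} {x y : α} :
    both r l S x y ⊆ both (clone r x y) l S x y := by
  rintro ⟨v, A⟩ hp
  rw [mem_both, mem_copies] at hp ⊢
  obtain ⟨⟨hv, hA, hc, h1, h2⟩, hx, hy⟩ := hp
  have hvy : v ≠ y := fun h => irrefl_of r v (h1 v (h ▸ hy))
  refine ⟨⟨hv, hA, hc, fun a ha => ?_, fun a ha b hb => ?_⟩, hx, hy⟩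
  · by_cases hay : a = y
    · subst hay
      exact (clone_right hvy).2 (h1 x hx)
    · exact (clone_of_ne hvy hay).2 (h1 a ha)
  · unfold clone
    apply h2 <;> split_ifs <;> assumption

/-- Inclusion-exclusion: a copy avoids x, avoids y, or uses both, and in the last case
incomparability forces both into its antichain. -/
theorem cnt_add_cnt_erase {r : α → α → Prop} [IsStrictOrder α r] {l : ℕ} {S : Finset α} {x y : α}
    (hxy : x ≠ y) (h1 : ¬ r x y) (h2 : ¬ r y x) :
    cnt r l S + cnt r l ((S.erase x).erase y) =
      cnt r l (S.erase x) + cnt r l (S.erase y) + (both r l S x y).card := by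
  have hi : copies r l (S.erase x) ∩ copies r l (S.erase y) = copies r l ((S.erase x).erase y) := by
    ext ⟨v, A⟩
    simp only [mem_inter, mem_copies, subset_erase, mem_erase]
    tauto
  have hd : Disjoint (copies r l (S.erase x) ∪ copies r l (S.erase y)) (both r l S x y) := by
    rw [disjoint_left]
    rintro ⟨v, A⟩ h h'
    rw [mem_both] at h'
    rcases mem_union.1 h with h | h
    · exact (mem_erase.1 ((mem_copies.1 h).2.1 h'.2.1)).1 rfl
    · exact (mem_erase.1 ((mem_copies.1 h).2.1 h'.2.2)).1 rfl
  have hu : copies r l S = copies r l (S.erase x) ∪ copies r l (S.erase y) ∪ both r l S x y := by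
    ext ⟨v, A⟩
    simp only [mem_union, mem_both, mem_copies, subset_erase, mem_erase]
    constructor
    · rintro ⟨hv, hA, hc, h3, h4⟩
      by_cases hx : x ∈ A <;> by_cases hy : y ∈ A
      · exact Or.inr ⟨⟨hv, hA, hc, h3, h4⟩, hx, hy⟩
      · refine Or.inl (Or.inr ⟨⟨?_, hv⟩, ⟨hA, hy⟩, hc, h3, h4⟩)
        rintro rfl
        exact h2 (h3 x hx)
      · refine Or.inl (Or.inl ⟨⟨?_, hv⟩, ⟨hA, hx⟩, hc, h3, h4⟩)
        rintro rfl
        exact h1 (h3 y hy)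
      · by_cases hvx : v = x
        · subst hvx
          exact Or.inl (Or.inr ⟨⟨hxy, hv⟩, ⟨hA, hy⟩, hc, h3, h4⟩)
        · exact Or.inl (Or.inl ⟨⟨hvx, hv⟩, ⟨hA, hx⟩, hc, h3, h4⟩)
    · tauto
  have hi' := congrArg card hi
  have := card_union_add_card_inter (copies r l (S.erase x)) (copies r l (S.erase y))
  rw [cnt, cnt, cnt, cnt, hu, card_union_of_disjoint hd]
  omega

/-- With x deleted, its clone y takes its place, and the transposition of x and y is an isomorphism.
-/
theorem cnt_clone_erase_left {r : α → α → Prop} {l : ℕ} {S : Finset α} {x y : α}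
    (hx : x ∈ S) (hy : y ∈ S) :
    cnt (clone r x y) l (S.erase x) = cnt r l (S.erase y) := by
  have h : cnt (clone r x y) l (S.erase x) =
      cnt (fun a b => r ((Equiv.swap x y).toEmbedding a) ((Equiv.swap x y).toEmbedding b)) l
        (S.erase x) := by
    refine cnt_congr fun a ha b hb => ?_
    have key : ∀ a ∈ S.erase x, (if a = y then x else a) = Equiv.swap x y a := by
      intro a ha
      split_ifs with h
      · rw [h, Equiv.swap_apply_right]
      · rw [Equiv.swap_apply_of_ne_of_ne (ne_of_mem_erase ha) h]
    simp only [clone, key a ha, key b hb, Equiv.coe_toEmbedding]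
  rw [h, cnt_map]
  congr 1
  ext a
  rw [mem_map_equiv, Equiv.symm_swap, mem_erase, mem_erase]
  by_cases hax : a = x
  · subst hax
    rw [Equiv.swap_apply_left]
    exact ⟨fun h => ⟨h.1.symm, hx⟩, fun h => ⟨h.1.symm, hy⟩⟩
  · by_cases hay : a = y
    · subst hay
      simp
    · rw [Equiv.swap_apply_of_ne_of_ne hax hay]
      simp [hax, hay]

theorem cnt_clone_of_notMem {r : α → α → Prop} {l : ℕ} {S : Finset α} {x y : α} (hy : y ∉ S) :
    cnt (clone r x y) l S = cnt r l S :=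
  cnt_congr fun _ ha _ hb =>
    clone_of_ne (fun h => hy (h ▸ ha)) (fun h => hy (h ▸ hb))

theorem cnt_clone {r : α → α → Prop} [IsStrictOrder α r] {l : ℕ} {S : Finset α} {x y : α}
    (hx : x ∈ S) (hy : y ∈ S) (hxy : x ≠ y) :
    cnt (clone r x y) l S + cnt r l ((S.erase x).erase y) =
      2 * cnt r l (S.erase y) + (both (clone r x y) l S x y).card := by
  have h := cnt_add_cnt_erase (r := clone r x y) (l := l) (S := S) (x := x) (y := y) hxy
    (by rw [clone_right hxy]; exact irrefl_of r x) (by rw [clone_left hxy]; exact irrefl_of r x)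
  rw [cnt_clone_erase_left hx hy, cnt_clone_of_notMem (notMem_erase _ _),
    cnt_clone_of_notMem (notMem_erase _ _)] at h
  omega

/-- On copies avoiding x or y the two clonings balance out. Copies through both survive either
cloning, so the only change on average is the gain of new ones. -/
theorem cnt_clone_add_cnt_clone {r : α → α → Prop} [IsStrictOrder α r] {l : ℕ} {S : Finset α}
    {x y : α} (hx : x ∈ S) (hy : y ∈ S) (hxy : x ≠ y) (h1 : ¬ r x y) (h2 : ¬ r y x) :
    cnt (clone r x y) l S + cnt (clone r y x) l S = 2 * cnt r l S +
      (both (clone r x y) l S x y \ both r l S x y).card +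
      (both (clone r y x) l S x y \ both r l S x y).card := by
  have e1 := cnt_clone (r := r) (l := l) hx hy hxy
  have e2 := cnt_clone (r := r) (l := l) hy hx hxy.symm
  have e3 := cnt_add_cnt_erase (r := r) (l := l) (S := S) hxy h1 h2
  have e4 := card_sdiff_add_card_eq_card (both_subset_clone (r := r) (l := l) (S := S) (x := x)
    (y := y))
  have e5 := card_sdiff_add_card_eq_card (both_subset_clone (r := r) (l := l) (S := S) (x := y)
    (y := x))
  rw [both_comm (clone r y x), both_comm r l S y x] at e5
  rw [both_comm (clone r y x), erase_right_comm] at e2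
  omega

end Clone

/-! ### Stable posets have a top antichain -/

section Stable

variable {α : Type u}

/-- Cloning never creates a copy containing both clones. -/
def Stable (r : α → α → Prop) (l : ℕ) (S : Finset α) : Prop :=
  ∀ x ∈ S, ∀ y ∈ S, x ≠ y → ¬ r x y → ¬ r y x → both (clone r x y) l S x y ⊆ both r l S x y

theorem insert_mem_both_clone {r : α → α → Prop} [IsStrictOrder α r] {l : ℕ} {S : Finset α}
    {x y v : α} {B : Finset α} (hv : v ∈ S) (hB : B ⊆ S) (hyS : y ∈ S) (hx : x ∈ B) (hy : y ∉ B)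
    (hc : B.card + 1 = l) (h : IsCopy r v B) (hyx : ¬ r y x) :
    (v, insert y B) ∈ both (clone r x y) l S x y := by
  have hvy : v ≠ y := fun e => hyx (e ▸ h.1 x hx)
  have hne : ∀ a ∈ B, a ≠ y := fun a ha e => hy (e ▸ ha)
  rw [mem_both, mem_copies]
  refine ⟨⟨hv, insert_subset hyS hB, by rw [card_insert_of_notMem hy, hc], fun a ha => ?_,
    fun a ha b hb => ?_⟩, mem_insert_of_mem hx, mem_insert_self _ _⟩
  · rcases mem_insert.1 ha with rfl | ha
    · exact (clone_right hvy).2 (h.1 x hx)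
    · exact (clone_of_ne hvy (hne a ha)).2 (h.1 a ha)
  · have key : ∀ a ∈ insert y B, (if a = y then x else a) ∈ B := by
      intro a ha
      split_ifs with e
      · exact hx
      · exact mem_of_mem_insert_of_ne ha e
    exact h.2 _ (key a ha) _ (key b hb)

/-- Exchange some z ≠ x of A for y: the result is a copy once y is a clone of x, hence by stability
already a copy. This settles every element of A except z. -/
theorem Stable.extend {r : α → α → Prop} [IsStrictOrder α r] {l : ℕ} (hl : 2 ≤ l) {S : Finset α}
    (hS : Stable r l S) {v x y : α} {A : Finset α} (hA : (v, A) ∈ copies r l S) (hx : x ∈ A)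
    (hyS : y ∈ S) (hyA : y ∉ A) (h1 : ¬ r x y) (h2 : ¬ r y x) :
    r v y ∧ ∀ a ∈ A, ¬ r a y ∧ ¬ r y a := by
  rw [mem_copies] at hA
  obtain ⟨hv, hAS, hc, h3, h4⟩ := hA
  have hxy : x ≠ y := fun h => hyA (h ▸ hx)
  have key : ∀ z ∈ A, z ≠ x → (v, insert y (A.erase z)) ∈ both r l S x y := fun z hz hzx =>
    hS x (hAS hx) y hyS hxy h1 h2 <| insert_mem_both_clone hv ((erase_subset _ _).trans hAS) hyS
      (mem_erase.2 ⟨hzx.symm, hx⟩) (fun h => hyA (mem_of_mem_erase h))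
      (card_erase_add_one hz |>.trans hc)
      ⟨fun a ha => h3 a (mem_of_mem_erase ha),
        fun a ha b hb => h4 a (mem_of_mem_erase ha) b (mem_of_mem_erase hb)⟩ h2
  have key2 : ∀ z ∈ A, z ≠ x → r v y ∧ ∀ a ∈ A, a ≠ z → ¬ r a y ∧ ¬ r y a := by
    intro z hz hzx
    have := key z hz hzx
    rw [mem_both, mem_copies] at this
    obtain ⟨⟨-, -, -, h5, h6⟩, -⟩ := this
    refine ⟨h5 y (mem_insert_self _ _), fun a ha haz => ?_⟩
    have ha' : a ∈ insert y (A.erase z) := mem_insert_of_mem (mem_erase.2 ⟨haz, ha⟩)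
    exact ⟨h6 a ha' y (mem_insert_self _ _), h6 y (mem_insert_self _ _) a ha'⟩
  obtain ⟨z, hz, hzx⟩ := exists_mem_ne (by omega : 1 < A.card) x
  refine ⟨(key2 z hz hzx).1, fun a ha => ?_⟩
  by_cases haz : a = z
  · subst haz
    -- For l ≥ 3 a second exchange handles z. For l = 2 there is no other element to exchange;
    -- instead, stability applied to singletons shows that incomparable elements have the same
    -- strict lower sets.
    rcases hl.eq_or_lt with rfl | hl3
    · have down : ∀ x ∈ S, ∀ y ∈ S, x ≠ y → ¬ r x y → ¬ r y x → ∀ w ∈ S, r w x → r w y := by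
        intro x hx y hy hxy h1 h2 w hw hwx
        have := hS x hx y hy hxy h1 h2 (insert_mem_both_clone (B := {x}) hw
          (singleton_subset_iff.2 hx) hy (mem_singleton_self x)
          (fun h => hxy (mem_singleton.1 h).symm) (by simp)
          ⟨by simpa using hwx, by simpa using irrefl_of r x⟩ h2)
        rw [mem_both, mem_copies] at this
        exact this.1.2.2.2.1 y (mem_insert_self _ _)
      refine ⟨fun h => ?_, fun h => ?_⟩
      · exact h4 a ha x hx (down y hyS x (hAS hx) hxy.symm h2 h1 a (hAS ha) h)
      · exact h2 (down a (hAS ha) x (hAS hx) hzx (h4 a ha x hx) (h4 x hx a ha) y hyS h)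
    · obtain ⟨w, hw⟩ : ((A.erase x).erase a).Nonempty := by
        rw [← card_pos, card_erase_of_mem (mem_erase.2 ⟨hzx, ha⟩), card_erase_of_mem hx]
        omega
      rw [mem_erase, mem_erase] at hw
      exact (key2 w hw.2.2 hw.2.1).2 a ha hw.1.symm
  · exact (key2 z hz hzx).2 a ha haz

/-- T consists of the elements incomparable to a suitable x (x included), and S' drops the elements
above x. By `Stable.extend`, T is an antichain above the rest of S'. -/
theorem Stable.exists_isTop {r : α → α → Prop} [IsStrictOrder α r] {l : ℕ} (hl : 2 ≤ l)
    {S : Finset α} (hS : Stable r l S) (hpos : 0 < cnt r l S) :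
    ∃ S' ⊆ S, ∃ T, IsTop r S' T ∧ l ≤ T.card ∧ 1 ≤ (S' \ T).card ∧ cnt r l S' = cnt r l S := by
  obtain ⟨⟨v₀, A₀⟩, hp₀⟩ := card_pos.1 hpos
  obtain ⟨x₀, hx₀⟩ : A₀.Nonempty := card_pos.1 (by have := (mem_copies.1 hp₀).2.2.1; omega)
  -- Fewest elements above x: an element above x has strictly fewer above it, so it is in the
  -- antichain of no copy. Dropping the elements above x therefore loses nothing.
  obtain ⟨x, hxX, hmin⟩ := exists_min_image {x ∈ S | ∃ p ∈ copies r l S, x ∈ p.2}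
    (fun x => #{a ∈ S | r x a})
    ⟨x₀, mem_filter.2 ⟨(mem_copies.1 hp₀).2.1 hx₀, _, hp₀, hx₀⟩⟩
  obtain ⟨hxS, ⟨v, A⟩, hA, hxA⟩ := mem_filter.1 hxX
  obtain ⟨hv, hAS, hc, h3, h4⟩ := mem_copies.1 hA
  simp only at hxA
  have hvx := h3 x hxA
  -- every element incomparable to `x` lies in a common antichain with `x`
  have join : ∀ t ∈ S, ¬ r x t → ¬ r t x → ∃ A', (v, A') ∈ copies r l S ∧ x ∈ A' ∧ t ∈ A' := by
    intro t ht h1 h2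
    by_cases htA : t ∈ A
    · exact ⟨A, hA, hxA, htA⟩
    · obtain ⟨hvt, hAt⟩ := hS.extend hl hA hxA ht htA h1 h2
      obtain ⟨z, hz, hzx⟩ := exists_mem_ne (by omega : 1 < A.card) x
      refine ⟨insert t (A.erase z), mem_copies.2 ⟨hv, ?_, ?_, ?_, ?_⟩,
        mem_insert_of_mem (mem_erase.2 ⟨hzx.symm, hxA⟩), mem_insert_self _ _⟩
      · exact insert_subset ht ((erase_subset _ _).trans hAS)
      · rw [card_insert_of_notMem (fun h => htA (mem_of_mem_erase h)), card_erase_add_one hz, hc]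
      · intro a ha
        rcases mem_insert.1 ha with rfl | ha
        · exact hvt
        · exact h3 a (mem_of_mem_erase ha)
      · intro a ha b hb
        rcases mem_insert.1 ha with e | ha <;> rcases mem_insert.1 hb with e' | hb
        · rw [e, e']
          exact irrefl_of r t
        · rw [e]
          exact (hAt b (mem_of_mem_erase hb)).2
        · rw [e']
          exact (hAt a (mem_of_mem_erase ha)).1
        · exact h4 a (mem_of_mem_erase ha) b (mem_of_mem_erase hb)
  have htop : IsTop r {a ∈ S | ¬ r x a} {a ∈ S | ¬ r x a ∧ ¬ r a x} := by
    refine ⟨fun a ha => ?_, fun t ht a ha => ?_⟩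
    · rw [mem_filter] at ha ⊢
      exact ⟨ha.1, ha.2.1⟩
    · rw [mem_filter] at ht ha
      obtain ⟨htS, h1, h2⟩ := ht
      obtain ⟨A', hA', hxA', htA'⟩ := join t htS h1 h2
      have hA'' := (mem_copies.1 hA').2.2.2.2
      rw [mem_filter]
      constructor
      · rintro hat ⟨haS, -, hax⟩
        by_cases haA : a ∈ A'
        · exact hA'' a haA t htA' hat
        · exact ((hS.extend hl hA' hxA' haS haA ha.2 hax).2 t htA').2 hat
      · intro h
        have hax : r a x := by
          by_contra hax
          exact h ⟨ha.1, ha.2, hax⟩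
        by_contra hat
        have hta : ¬ r t a := fun hta => h2 (trans_of r hta hax)
        have haA : a ∉ A' := fun haA => hA'' a haA x hxA' hax
        exact ((hS.extend hl hA' htA' ha.1 haA hta hat).2 x hxA').2 hax
  refine ⟨{a ∈ S | ¬ r x a}, filter_subset _ _, _, htop, ?_, ?_, ?_⟩
  · rw [← hc]
    refine card_le_card fun a ha => mem_filter.2 ⟨hAS ha, h4 x hxA a ha, h4 a ha x hxA⟩
  · rw [Nat.one_le_iff_ne_zero, ← Nat.pos_iff_ne_zero, card_pos]
    refine ⟨v, mem_sdiff.2 ⟨mem_filter.2 ⟨hv, fun h => asymm_of r h hvx⟩, fun h => ?_⟩⟩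
    exact (mem_filter.1 h).2.2 hvx
  · rw [cnt, cnt]
    congr 1
    refine (copies_mono (filter_subset _ _)).antisymm ?_
    rintro ⟨w, B⟩ hB
    obtain ⟨hw, hBS, hBc, h5, h6⟩ := mem_copies.1 hB
    have hBx : ∀ b ∈ B, ¬ r x b := by
      intro b hb hxb
      have h7 := hmin b (mem_filter.2 ⟨hBS hb, _, hB, hb⟩)
      refine absurd (card_lt_card (ssubset_iff_of_subset ?_ |>.2 ⟨b, ?_, ?_⟩)) (not_lt_of_ge h7)
      · intro a ha
        rw [mem_filter] at ha ⊢
        exact ⟨ha.1, trans_of r hxb ha.2⟩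
      · exact mem_filter.2 ⟨hBS hb, hxb⟩
      · exact fun h => irrefl_of r b (mem_filter.1 h).2
    obtain ⟨b, hb⟩ : B.Nonempty := card_pos.1 (by omega)
    exact mem_copies.2 ⟨mem_filter.2 ⟨hw, fun h => hBx b hb (trans_of r h (h5 b hb))⟩,
      fun a ha => mem_filter.2 ⟨hBS ha, hBx a ha⟩, hBc, h5, h6⟩

theorem choose_add_ge (a b : ℕ) {k : ℕ} (hk : 1 ≤ k) :
    a.choose k + b.choose k ≤ (a + b).choose k := by
  induction a with
  | zero => simp [Nat.choose_eq_zero_of_lt (show 0 < k by omega)]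
  | succ a ih =>
    obtain ⟨k, rfl⟩ : ∃ j, k = j + 1 := ⟨k - 1, by omega⟩
    rw [Nat.choose_succ_succ', show a + 1 + b = (a + b) + 1 by ring, Nat.choose_succ_succ' (a + b)]
    have := Nat.choose_le_choose k (show a ≤ a + b by omega)
    omega

theorem choose_add_ge' (q m : ℕ) {k : ℕ} (hk : 1 ≤ k) :
    q.choose (k + 1) + m.choose (k + 1) + q * m.choose k ≤ (q + m).choose (k + 1) := by
  induction q with
  | zero => simp
  | succ q ih =>
    rw [Nat.choose_succ_succ', show q + 1 + m = (q + m) + 1 by ring, Nat.choose_succ_succ' (q + m),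
      add_mul]
    have := choose_add_ge q m hk
    omega

theorem Stable.isTop {r : α → α → Prop} [IsStrictOrder α r] {l : ℕ} (hl : 2 ≤ l)
    {S : Finset α} (hS : Stable r l S) (hpos : 0 < cnt r l S) (hM : M l S.card ≤ cnt r l S + 1) :
    ∃ T, IsTop r S T ∧ l ≤ T.card ∧ 1 ≤ (S \ T).card := by
  obtain ⟨S', hS', T, hT, hTc, hD, hcnt⟩ := hS.exists_isTop hl hpos
  rcases hS'.eq_or_ssubset with rfl | hss
  · exact ⟨T, hT, hTc, hD⟩
  · exfalso
    have h1 := card_lt_card hss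
    have h2 := card_sdiff_add_card_eq_card hT.1
    have h3 := hT.cnt_eq (l := l) (by omega)
    have h4 := cnt_le r l (S' \ T)
    obtain ⟨k, hk⟩ : ∃ k, S.card = (S' \ T).card + (T.card + 1 + k) :=
      ⟨S.card - S'.card - 1, by omega⟩
    have h5 := max_add_le (l := l) (by omega) (S' \ T).card (T.card + 1 + k)
    obtain ⟨j, rfl⟩ : ∃ j, l = j + 2 := ⟨l - 2, by omega⟩
    -- Moving the unused elements of S into the top antichain gains at least C(|T|, l - 1) ≥ l ≥ 2
    -- antichains, more than the deficit of one allows.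
    have h6 : T.card.choose (j + 2) + 2 ≤ (T.card + 1 + k).choose (j + 2) := by
      have h7 := Nat.choose_le_choose (j + 2) (show T.card + 1 ≤ T.card + 1 + k by omega)
      have h8 := Nat.choose_le_choose (j + 1) hTc
      have h9 : (j + 2).choose (j + 1) = j + 2 := Nat.choose_succ_self_right (j + 1)
      have h10 : (T.card + 1).choose (j + 2) = T.card.choose (j + 1) + T.card.choose (j + 2) :=
        Nat.choose_succ_succ' _ _
      omega
    rw [← hk] at h5
    nlinarith

theorem stable_of_max {r : α → α → Prop} [IsStrictOrder α r] {l : ℕ} {S : Finset α}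
    (hM : cnt r l S = M l S.card) : Stable r l S := by
  intro x hx y hy hxy h1 h2
  have h := cnt_clone_add_cnt_clone (l := l) hx hy hxy h1 h2
  have h3 := cnt_le (clone r x y) l S
  have h4 := cnt_le (clone r y x) l S
  rw [← sdiff_eq_empty_iff_subset, ← card_eq_zero]
  omega

theorem exists_isTop_of_max {r : α → α → Prop} [IsStrictOrder α r] {l : ℕ} (hl : 2 ≤ l)
    {S : Finset α} (hM : cnt r l S = M l S.card) (hlS : l < S.card) :
    ∃ T, IsTop r S T ∧ l ≤ T.card ∧ 1 ≤ (S \ T).card :=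
  (stable_of_max hM).isTop hl (hM ▸ max_pos (by omega) hlS) (by omega)

end Stable

/-! ### Inequalities between layer sizes -/

section Numerics

variable {α : Type u}

theorem le_choose {n k : ℕ} (hk : 1 ≤ k) (hkn : k < n) : n ≤ n.choose k := by
  induction n with
  | zero => omega
  | succ n ih =>
    obtain ⟨j, rfl⟩ : ∃ j, k = j + 1 := ⟨k - 1, by omega⟩
    rw [Nat.choose_succ_succ']
    rcases (show j + 1 ≤ n by omega).eq_or_lt with h | h
    · subst h
      rw [Nat.choose_succ_self_right, Nat.choose_self]
    · have := ih h
      have : 0 < n.choose j := Nat.choose_pos (by omega)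
      omega

theorem two_mul_choose_two (n : ℕ) : (2 * n.choose 2 : ℤ) = n * (n - 1) := by
  induction n with
  | zero => simp
  | succ n ih =>
    rw [Nat.choose_succ_succ', Nat.choose_one_right]
    push_cast
    linarith

theorem exists_decomposition {r : α → α → Prop} [IsStrictOrder α r] {l : ℕ} (hl : 2 ≤ l)
    {D : Finset α} (hM : cnt r l D = M l D.card) (hD : 2 ≤ D.card) :
    ∃ e, 1 ≤ e ∧ e < D.card ∧ M l D.card = M l e + e * (D.card - e).choose l ∧
      ∀ w ∈ D, #{a ∈ D | r a w} ≤ e := by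
  rcases le_or_gt D.card l with h | h
  · refine ⟨D.card - 1, by omega, by omega, ?_, fun w hw => ?_⟩
    · rw [max_eq_zero h, max_eq_zero (show D.card - 1 ≤ l by omega),
        Nat.choose_eq_zero_of_lt (by omega)]
      simp
    · rw [← card_erase_of_mem hw]
      refine card_le_card fun a ha => ?_
      rw [mem_filter] at ha
      exact mem_erase.2 ⟨fun h => irrefl_of r w (h ▸ ha.2), ha.1⟩
  · obtain ⟨T, hT, hTl, hDT⟩ := exists_isTop_of_max hl hM h
    have h1 := card_sdiff_add_card_eq_card hT.1
    have h2 := hT.cnt_eq (l := l) (by omega)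
    have h3 := cnt_le r l (D \ T)
    have h4 := max_add_le (l := l) (by omega) (D \ T).card T.card
    refine ⟨(D \ T).card, hDT, by omega, ?_, fun w hw => card_le_card fun a ha => ?_⟩
    · rw [h1] at h4
      rw [show D.card - (D \ T).card = T.card by omega]
      omega
    · rw [mem_filter] at ha
      refine mem_sdiff.2 ⟨ha.1, fun haT => ?_⟩
      have hwT : w ∉ T := fun hwT => (hT.2 w hwT a ha.1).1 ha.2 haT
      exact asymm_of r ha.2 ((hT.2 a haT w hw).2 hwT)

theorem exists_max_eq_of_max {r : α → α → Prop} [IsStrictOrder α r] {l : ℕ} (hl : 2 ≤ l)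
    {S : Finset α} (hM : cnt r l S = M l S.card) (hlS : l < S.card) :
    ∃ d m, d < S.card ∧ d + m = S.card ∧ M l S.card = M l d + d * m.choose l := by
  obtain ⟨T, hT, hTl, -⟩ := exists_isTop_of_max hl hM hlS
  have h1 := card_sdiff_add_card_eq_card hT.1
  have h2 := hT.cnt_eq (l := l) (by omega)
  have h3 := cnt_le r l (S \ T)
  have h4 := max_add_le (l := l) (by omega) (S \ T).card T.card
  rw [h1] at h4
  exact ⟨(S \ T).card, T.card, by omega, h1, by omega⟩

theorem exists_max_eq {l n : ℕ} (hl : 2 ≤ l) (h : l < n) :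
    ∃ d m, d < n ∧ d + m = n ∧ M l n = M l d + d * m.choose l := by
  obtain ⟨r, hr, hc⟩ := attained_max l n
  have := exists_max_eq_of_max (r := r) (S := univ) hl (by simpa using hc) (by simpa using h)
  simpa using this

/-- Merging the top two layers, of sizes d - e and m, into one cannot beat the maximum. -/
theorem mul_le_of_decomposition {l d e m : ℕ} (hl : 2 ≤ l) (hm : l ≤ m) (hed : e < d)
    (hd : M l d = M l e + e * (d - e).choose l) (h : M l (d + m) = M l d + d * m.choose l) :
    l * e + l ≤ m + 1 := by
  obtain ⟨q, hq, rfl⟩ : ∃ q, 0 < q ∧ d = e + q := ⟨d - e, by omega, by omega⟩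
  obtain ⟨k, rfl⟩ : ∃ k, l = k + 1 := ⟨l - 1, by omega⟩
  have h1 := max_add_le (l := k + 1) (by omega) e (q + m)
  have h2 := choose_add_ge' q m (k := k) (by omega)
  rw [show e + q - e = q by omega] at hd
  rw [← add_assoc, h, hd] at h1
  have h3 : e * (q * m.choose k) ≤ q * m.choose (k + 1) := by nlinarith
  have h4 : e * m.choose k ≤ m.choose (k + 1) := by
    refine Nat.le_of_mul_le_mul_left ?_ hq
    calc q * (e * m.choose k) = e * (q * m.choose k) := by ring
      _ ≤ _ := h3
  have h5 := Nat.choose_succ_right_eq m k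
  have h6 : 0 < m.choose k := Nat.choose_pos (by omega)
  have h7 : (k + 1) * e ≤ m - k := by
    refine Nat.le_of_mul_le_mul_left ?_ h6
    rw [← h5]
    nlinarith
  omega

/-- Moving one element from the top layer to the layer below it cannot beat the maximum. -/
theorem le_two_mul_of_decomposition {d e m : ℕ} (he : 1 ≤ e) (hm : 2 ≤ m) (hed : e < d)
    (hd : M 2 d = M 2 e + e * (d - e).choose 2) (h : M 2 (d + m) = M 2 d + d * m.choose 2) :
    m ≤ 2 * d + 1 := by
  obtain ⟨q, hq, rfl⟩ : ∃ q, 0 < q ∧ d = e + q := ⟨d - e, by omega, by omega⟩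
  obtain ⟨p, rfl⟩ : ∃ p, m = p + 1 := ⟨m - 1, by omega⟩
  rw [show e + q - e = q by omega] at hd
  have h1 := max_add_le (l := 2) (by omega) e (q + 1)
  have h2 := max_add_le (l := 2) (by omega) (e + (q + 1)) p
  rw [show e + (q + 1) + p = e + q + (p + 1) by ring, h, hd] at h2
  have h3 : (q + 1).choose 2 = q + q.choose 2 := by
    rw [Nat.choose_succ_succ', Nat.choose_one_right]
  have h4 : (p + 1).choose 2 = p + p.choose 2 := by
    rw [Nat.choose_succ_succ', Nat.choose_one_right]
  rw [h3] at h1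
  rw [h4] at h2
  have h5 := two_mul_choose_two p
  have h6 : (1 : ℤ) ≤ e * q := by exact_mod_cast Nat.mul_pos he hq
  have h7 : (1 + p.choose 2 : ℤ) ≤ (e + q) * p := by
    zify at h1 h2
    linarith
  by_contra hcon
  have h8 : (2 * (e + q) + 1 : ℤ) ≤ p := by
    zify at hcon
    omega
  have h9 : (0 : ℤ) < p := by omega
  nlinarith

/-- Here `h` is twice the comparison of d(m - 1) - 1, the exact number of copies through y, with the
upper bound C(j, 2) + (d - t)(m - 1 - j) + te. The misplacement of y is measured by j, the elements
of T above it, and t, the bottom elements not below it. -/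
theorem excess_eq {d m j t e : ℤ} (he : 1 ≤ e) (hed : e < d) (hem : 2 * e + 2 ≤ m + 1)
    (hmd : m ≤ 2 * d + 1) (ht0 : 0 ≤ t) (ht : t ≤ 2) (hj0 : 0 ≤ j) (hj : j + 2 ≤ m)
    (htj : ¬ (t = 0 ∧ j = 0))
    (h : 2 * (d * (m - 1)) ≤ j * (j - 1) + 2 * ((d - t) * (m - 1 - j)) + 2 * (t * e) + 2) :
    e = 1 ∧ m = 3 := by
  rcases hj0.eq_or_lt with rfl | hj0
  · have h1 : t * (m - 1 - e) ≤ 1 := by nlinarith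
    have : 1 ≤ t := by omega
    have h2 : e ≤ m - 1 - e := by omega
    have : m - 1 - e ≤ 1 := by nlinarith
    omega
  · exfalso
    -- The slacks u in j + 2 ≤ m and δ - 1 in m ≤ 2d + 1 turn `h` into a small bound on products of
    -- nonnegative terms.
    obtain ⟨u, hu⟩ : ∃ u, m = j + 2 + u := ⟨m - 2 - j, by ring⟩
    obtain ⟨δ, hδ⟩ : ∃ δ, 2 * d + 2 = m + δ := ⟨2 * d + 2 - m, by ring⟩
    have hu0 : 0 ≤ u := by omega
    have hδ1 : 1 ≤ δ := by omega
    have h1 : j * (1 + u + δ) + 2 * t * (1 + u - e) ≤ 2 := by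
      have hd2 : 2 * d = j + u + δ := by omega
      have : j * (2 * d - j + 1) + 2 * t * (m - 1 - j - e) ≤ 2 := by nlinarith
      rw [hd2, hu] at this
      nlinarith
    have hju : 0 ≤ (j - 1) * u := mul_nonneg (by omega) hu0
    have hjδ : 0 ≤ (j - 1) * (δ - 1) := mul_nonneg (by omega) (by omega)
    rcases (show t = 0 ∨ t = 1 ∨ t = 2 by omega) with rfl | rfl | rfl
    · have : j = 1 ∧ u = 0 ∧ δ = 1 := by
        refine ⟨?_, ?_, ?_⟩ <;> nlinarith
      omega
    · have : j * (u + δ) + u ≤ 1 := by nlinarith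
      have : j = 1 ∧ u = 0 ∧ δ = 1 := by
        refine ⟨?_, ?_, ?_⟩ <;> nlinarith
      omega
    · have h3 : j * (u + δ - 1) + 2 * u ≤ 0 := by nlinarith
      have hu' : u = 0 := by nlinarith
      subst hu'
      have : δ = 1 := by nlinarith
      subst this
      have : j + 1 ≤ 2 * e := by nlinarith
      omega

/-- The ways in which a poset with one copy less than the maximum can be realised. -/
def Outcome (l n : ℕ) : Prop :=
  (∃ d m c, 0 < m ∧ d + m = n ∧ Attained l d c ∧ c + d * m.choose l + 1 = M l n) ∨
    (l = 2 ∧ n = 5 ∧ M 2 5 = 6)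

theorem outcome_of_isTop {r : α → α → Prop} [IsStrictOrder α r] {l : ℕ} (hl : 1 ≤ l)
    {S T : Finset α} (h : cnt r l S + 1 = M l S.card) (hT : IsTop r S T) (hT0 : 0 < T.card) :
    Outcome l S.card := by
  refine Or.inl ⟨(S \ T).card, T.card, _, hT0, card_sdiff_add_card_eq_card hT.1,
    attained_cnt r l (S \ T), ?_⟩
  rw [← h, hT.cnt_eq hl]

/-- Two bottom elements under an antichain of size m - 1 give 2·C(m - 1, 2) ≤ C(m, 2), so m ≤ 4. For
m = 3, `𝒜₂ ⊕ 𝒜₂` has 2 copies, one below the maximum; m = 4 is the exceptional case. -/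
theorem outcome_of_one {m : ℕ} (hm : 2 ≤ M 2 (1 + m)) (h : M 2 (1 + m) = m.choose 2) :
    Outcome 2 (1 + m) := by
  have h0 : 3 ≤ m := by
    by_contra hcon
    have : m.choose 2 ≤ (2 : ℕ).choose 2 := Nat.choose_le_choose 2 (by omega)
    simp only [Nat.choose_self] at this
    omega
  obtain ⟨p, rfl⟩ : ∃ p, m = p + 1 := ⟨m - 1, by omega⟩
  have h1 := max_add_le (l := 2) (by omega) 2 p
  rw [show 2 + p = 1 + (p + 1) by ring, h, Nat.choose_succ_succ', Nat.choose_one_right] at h1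
  have h2 : p ≤ 3 := by
    have := two_mul_choose_two p
    zify at h1 ⊢
    have h0' : (2 : ℤ) ≤ p := by exact_mod_cast (show 2 ≤ p by omega)
    nlinarith
  have h3 : p = 2 ∨ p = 3 := by omega
  rcases h3 with rfl | rfl
  · refine Or.inl ⟨2, 2, 0, by omega, rfl, attained_zero 2 2 (by omega), ?_⟩
    rw [h]
    decide
  · exact Or.inr ⟨rfl, rfl, by rw [show 5 = 1 + (3 + 1) from rfl, h]; decide⟩

/-- Layers 1, d - 1, 3 are compared with layers 1, d - 2, 4, which win unless d = 2. -/
theorem card_eq_five {d : ℕ} (hd : 2 ≤ d) (h1 : M 2 d = M 2 1 + 1 * (d - 1).choose 2)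
    (h : M 2 (d + 3) = M 2 d + d * (3 : ℕ).choose 2) : d + 3 = 5 ∧ M 2 5 = 6 := by
  obtain ⟨q, rfl⟩ : ∃ q, d = q + 2 := ⟨d - 2, by omega⟩
  have h2 := max_add_le (l := 2) (by omega) 1 q
  have h3 := max_add_le (l := 2) (by omega) (1 + q) 4
  have h4 : (q + 2 - 1).choose 2 = q + q.choose 2 := by
    rw [show q + 2 - 1 = q + 1 by omega, Nat.choose_succ_succ', Nat.choose_one_right]
  have h5 : (3 : ℕ).choose 2 = 3 := by decide
  have h6 : (4 : ℕ).choose 2 = 6 := by decide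
  have h7 : M 2 1 = 0 := max_eq_zero (by omega)
  rw [show 1 + q + 4 = q + 2 + 3 by ring] at h3
  rw [h4] at h1
  rw [h5] at h
  rw [h6] at h3
  have hq : q = 0 := by omega
  subst hq
  refine ⟨rfl, ?_⟩
  rw [show 5 = 0 + 2 + 3 from rfl, h, h1, h7]
  decide

end Numerics

/-! ### Posets that are maximal except for one misplaced element -/

section CloneTop

variable {α : Type u}

/-- Replacing `y` by a clone of `x` turns `S`, which has one copy less than the maximum, into a
maximal poset with top layer `T` containing both clones. -/
structure NearTop (r : α → α → Prop) (l : ℕ) (S T : Finset α) (x y : α) : Prop where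
  x_mem : x ∈ T
  y_mem : y ∈ T
  subset : T ⊆ S
  ne : x ≠ y
  not_lt : ¬ r x y
  not_gt : ¬ r y x
  cnt_add_one : cnt r l S + 1 = M l S.card
  two_le : 2 ≤ M l S.card
  l_le : l ≤ T.card
  pos : 1 ≤ (S \ T).card
  lt : ∀ a ∈ S \ T, ∀ t ∈ T, t ≠ y → r a t
  antichain : ∀ s ∈ T, ∀ t ∈ T, s ≠ y → t ≠ y → ¬ r s t
  max_bot : cnt r l (S \ T) = M l (S \ T).card
  max_eq : M l ((S \ T).card + T.card) = M l (S \ T).card + (S \ T).card * T.card.choose l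
  few : (both (clone r x y) l S x y \ both r l S x y).card ≤ 2

variable {r : α → α → Prop} {l : ℕ} {S T : Finset α} {x y : α}

/-- Maximality of the clone forces a maximal bottom. The bound in `few` holds because the two clone
counts sum to at most 2M, while twice the original count is 2M - 2. -/
theorem nearTop_of_clone [IsStrictOrder α r] (hl : 2 ≤ l) (hxy : x ≠ y) (h1 : ¬ r x y)
    (h2 : ¬ r y x) (hr : cnt r l S + 1 = M l S.card) (hM : 2 ≤ M l S.card)
    (hc : cnt (clone r x y) l S = M l S.card) (hT : IsTop (clone r x y) S T) (hxT : x ∈ T)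
    (hy : y ∈ S) (hTl : l ≤ T.card) (hD : 1 ≤ (S \ T).card) : NearTop r l S T x y := by
  have hyT : y ∈ T := by
    by_contra hyT
    exact irrefl_of r x ((clone_left hxy).1 ((hT.2 x hxT y hy).2 hyT))
  have hne : ∀ a ∈ S \ T, a ≠ y := fun a ha e => (mem_sdiff.1 ha).2 (e ▸ hyT)
  have hcD : cnt (clone r x y) l (S \ T) = cnt r l (S \ T) :=
    cnt_clone_of_notMem fun h => (mem_sdiff.1 h).2 hyT
  have e1 := hT.cnt_eq (l := l) (by omega)
  have e2 := cnt_le r l (S \ T)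
  have e3 := max_add_le (l := l) (by omega) (S \ T).card T.card
  have e4 := card_sdiff_add_card_eq_card hT.1
  have e5 := cnt_clone_add_cnt_clone (r := r) (l := l) (hT.1 hxT) hy hxy h1 h2
  have e6 := cnt_le (clone r y x) l S
  refine ⟨hxT, hyT, hT.1, hxy, h1, h2, hr, hM, hTl, hD, fun a ha t ht hty => ?_,
    fun s hs t ht hsy hty hst => ?_, ?_, ?_, ?_⟩
  · exact (clone_of_ne (hne a ha) hty).1
      ((hT.2 t ht a (mem_sdiff.1 ha).1).2 (mem_sdiff.1 ha).2)
  · exact (hT.2 t ht s (hT.1 hs)).1 ((clone_of_ne hsy hty).2 hst) hs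
  · rw [e4] at e3
    omega
  · rw [e4] at e3 ⊢
    omega
  · omega

namespace NearTop

theorem card_eq (h : NearTop r l S T x y) : (S \ T).card + T.card = S.card :=
  card_sdiff_add_card_eq_card h.subset

theorem not_lt_bot [IsStrictOrder α r] (h : NearTop r l S T x y) {a : α} (ha : a ∈ S \ T) :
    ¬ r y a :=
  fun hya => h.not_gt (trans_of r hya (h.lt a ha x h.x_mem h.ne))

theorem isTop_erase (h : NearTop r l S T x y) : IsTop r (S.erase y) (T.erase y) := by
  refine ⟨erase_subset_erase y h.subset, fun t ht a ha => ?_⟩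
  rw [mem_erase] at ht ha
  constructor
  · intro hat haT
    exact h.antichain a (mem_of_mem_erase haT) t ht.2 ha.1 ht.1 hat
  · intro haT
    exact h.lt a (mem_sdiff.2 ⟨ha.2, fun h => haT (mem_erase.2 ⟨ha.1, h⟩)⟩) t ht.2 ht.1

/-- The number of copies that use `y`. -/
theorem card_copies_sdiff [IsStrictOrder α r] (h : NearTop r l S T x y) (hl : 2 ≤ l) :
    (copies r l S \ copies r l (S.erase y)).card + 1 =
      (S \ T).card * (T.card - 1).choose (l - 1) := by
  have e1 := card_sdiff_add_card_eq_card (copies_mono (r := r) (l := l) (erase_subset y S))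
  have e2 := h.isTop_erase.cnt_eq (l := l) (by omega)
  have e3 : S.erase y \ T.erase y = S \ T := by
    ext a
    have := h.y_mem
    simp only [mem_sdiff, mem_erase]
    constructor
    · rintro ⟨⟨h1, h2⟩, h3⟩
      exact ⟨h2, fun h => h3 ⟨h1, h⟩⟩
    · rintro ⟨h1, h2⟩
      exact ⟨⟨fun h => h2 (h ▸ this), h1⟩, fun h => h2 h.2⟩
  have e4 := h.max_eq
  rw [h.card_eq, ← h.cnt_add_one] at e4
  rw [e3, card_erase_of_mem h.y_mem, h.max_bot] at e2
  obtain ⟨m, hm⟩ : ∃ m, T.card = m + 1 :=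
    ⟨T.card - 1, by have := h.l_le; omega⟩
  obtain ⟨k, rfl⟩ : ∃ k, l = k + 1 := ⟨l - 1, by omega⟩
  rw [hm] at e4 e2 ⊢
  rw [Nat.choose_succ_succ', mul_add] at e4
  simp only [Nat.add_sub_cancel] at e2 ⊢
  rw [cnt] at e2 e4
  omega

theorem mem_copies_sdiff {v : α} {A : Finset α} :
    (v, A) ∈ copies r l S \ copies r l (S.erase y) ↔
      (v, A) ∈ copies r l S ∧ (v = y ∨ y ∈ A) := by
  rw [mem_sdiff, mem_copies, mem_copies, mem_erase, subset_erase]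
  tauto

/-- Antichains of `T` through `x` and `y` that do not survive in `r` are few. -/
theorem card_le_two [IsStrictOrder α r] (h : NearTop r l S T x y) {a : α} (ha : a ∈ S \ T)
    {F : Finset (Finset α)} (hF : ∀ B ∈ F, B ⊆ (T.erase y).erase x ∧ B.card + 2 = l)
    (hbad : ∀ B ∈ F, ¬ r a y ∨ ∃ b ∈ B, r b y ∨ r y b) : F.card ≤ 2 := by
  refine le_trans ?_ h.few
  refine card_le_card_of_injOn (fun B => (a, insert y (insert x B))) ?_ ?_
  · intro B hB
    obtain ⟨hBT, hc⟩ := hF B hB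
    have hxB : x ∉ B := fun hx => (mem_erase.1 (hBT hx)).1 rfl
    have hyB : y ∉ insert x B := by
      intro hy
      rcases mem_insert.1 hy with e | hy
      · exact h.ne e.symm
      · exact (mem_erase.1 (mem_erase.1 (hBT hy)).2).1 rfl
    have hxBT : insert x B ⊆ T.erase y :=
      insert_subset (mem_erase.2 ⟨h.ne, h.x_mem⟩) (hBT.trans (erase_subset _ _))
    refine mem_coe.2 (mem_sdiff.2 ⟨?_, fun hb => ?_⟩)
    · refine insert_mem_both_clone (mem_sdiff.1 ha).1
        ((hxBT.trans (erase_subset _ _)).trans h.subset) (h.subset h.y_mem)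
        (mem_insert_self _ _) hyB ?_ ⟨fun b hb => ?_, fun b hb c hc => ?_⟩ h.not_gt
      · rw [card_insert_of_notMem hxB, ← hc]
      · exact h.lt a ha b (mem_of_mem_erase (hxBT hb)) (ne_of_mem_erase (hxBT hb))
      · exact h.antichain b (mem_of_mem_erase (hxBT hb)) c (mem_of_mem_erase (hxBT hc))
          (ne_of_mem_erase (hxBT hb)) (ne_of_mem_erase (hxBT hc))
    · rw [mem_both, mem_copies] at hb
      obtain ⟨⟨-, -, -, h1, h2⟩, -⟩ := hb
      rcases hbad B hB with h3 | ⟨b, hb, h3 | h3⟩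
      · exact h3 (h1 y (mem_insert_self _ _))
      · exact h2 b (mem_insert_of_mem (mem_insert_of_mem hb)) y (mem_insert_self _ _) h3
      · exact h2 y (mem_insert_self _ _) b (mem_insert_of_mem (mem_insert_of_mem hb)) h3
  · intro B hB B' hB' e
    have key : ∀ B ∈ F, ((insert y (insert x B)).erase y).erase x = B := by
      intro B hB
      have hBT := (hF B hB).1
      have hxB : x ∉ B := fun hx => (mem_erase.1 (hBT hx)).1 rfl
      have hyB : y ∉ insert x B := by
        intro hy
        rcases mem_insert.1 hy with e | hy
        · exact h.ne e.symm
        · exact (mem_erase.1 (mem_erase.1 (hBT hy)).2).1 rfl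
      rw [erase_insert hyB, erase_insert hxB]
    simp only [Prod.mk.injEq, true_and] at e
    rw [← key B hB, e, key B' hB']

/-- Some element of `T` is comparable to `y`, or some element of `S \ T` is not below `y`. -/
theorem comparable_or_bot [IsStrictOrder α r] (h : NearTop r l S T x y) (hl : 2 ≤ l) :
    (∃ w ∈ T, r w y ∨ r y w) ∨ ∃ a ∈ S \ T, ¬ r a y := by
  by_contra hcon
  push Not at hcon
  have hT : IsTop r S T := by
    refine ⟨h.subset, fun t ht a ha => ⟨fun hat haT => ?_, fun haT => ?_⟩⟩
    · by_cases hay : a = y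
      · subst hay
        exact (hcon.1 t ht).2 hat
      · by_cases hty : t = y
        · subst hty
          exact (hcon.1 a haT).1 hat
        · exact h.antichain a haT t ht hay hty hat
    · have haD := mem_sdiff.2 ⟨ha, haT⟩
      by_cases hty : t = y
      · subst hty
        exact hcon.2 a haD
      · exact h.lt a haD t ht hty
  have e1 := hT.cnt_eq (l := l) (by omega)
  have e2 := h.max_eq
  rw [h.card_eq, ← h.cnt_add_one, ← h.max_bot] at e2
  omega

theorem card_erase_erase (h : NearTop r l S T x y) : ((T.erase y).erase x).card = T.card - 2 := by
  rw [card_erase_of_mem (mem_erase.2 ⟨h.ne, h.x_mem⟩), card_erase_of_mem h.y_mem]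
  omega

theorem above_subset [IsStrictOrder α r] (h : NearTop r l S T x y) {a : α} (ha : a ∈ S)
    (hya : r y a) :
    a ∈ (T.erase y).erase x := by
  refine mem_erase.2 ⟨fun e => h.not_gt (e ▸ hya), mem_erase.2 ⟨fun e => ?_, ?_⟩⟩
  · exact irrefl_of r y (by rwa [e] at hya)
  · by_contra haT
    exact h.not_lt_bot (mem_sdiff.2 ⟨ha, haT⟩) hya

theorem false_of_three_le [IsStrictOrder α r] (h : NearTop r l S T x y) (hl : 3 ≤ l) : False := by
  have hT2 := h.card_erase_erase
  have hmT := h.l_le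
  have hY := h.card_copies_sdiff (by omega)
  have hdm : (S \ T).card = 1 ∨ (2 ≤ (S \ T).card ∧ 2 * l ≤ T.card + 1) := by
    rcases h.pos.eq_or_lt with h1 | h1
    · exact Or.inl h1.symm
    · right
      -- With e ≥ 1, merging layers gives 2l ≤ le + l ≤ |T| + 1.
      obtain ⟨e, he1, hed, hde, -⟩ := exists_decomposition (by omega) h.max_bot h1
      have := mul_le_of_decomposition (by omega) hmT hed hde h.max_eq
      refine ⟨h1, ?_⟩
      nlinarith
  have hml : l + 1 ≤ T.card := by
    rcases hdm with h1 | ⟨-, h1⟩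
    · by_contra hcon
      have e1 := h.max_eq
      have e2 := h.two_le
      rw [h.card_eq, h1, show T.card = l by omega, Nat.choose_self,
        max_eq_zero (show 1 ≤ l by omega)] at e1
      omega
    · omega
  have hC2 : T.card - 2 ≤ (T.card - 2).choose (l - 2) := le_choose (by omega) (by omega)
  -- If a is not below y, every antichain of size l in T through x and y is new over a. So C(|T| -
  -- 2, l - 2) ≤ 2, which leaves l = 3, |T| = 4 and a single bottom element; then no copy uses y,
  -- whereas two should.
  by_cases hE : ∃ a ∈ S \ T, ¬ r a y
  · obtain ⟨a, ha, hay⟩ := hE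
    have h2 := h.card_le_two ha (F := ((T.erase y).erase x).powersetCard (l - 2))
      (fun B hB => by rw [mem_powersetCard] at hB; exact ⟨hB.1, by omega⟩)
      (fun B _ => Or.inl hay)
    rw [card_powersetCard, hT2] at h2
    have hm4 : T.card = 4 := by omega
    have hl3 : l = 3 := by omega
    subst hl3
    have hd1 : (S \ T).card = 1 := by omega
    have hYe : copies r 3 S \ copies r 3 (S.erase y) = ∅ := by
      rw [eq_empty_iff_forall_notMem]
      rintro ⟨v, A⟩ hA
      rw [mem_copies_sdiff, mem_copies] at hA
      obtain ⟨⟨hv, hAS, hc, h3, h4⟩, rfl | hyA⟩ := hA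
      · have := card_le_card (fun b hb => h.above_subset (hAS hb) (h3 b hb))
        omega
      · have hvy := h3 y hyA
        by_cases hvT : v ∈ T
        · have hvy' : v ≠ y := fun e => irrefl_of r y (by rwa [e] at hvy)
          exact hay (trans_of r (h.lt a ha v hvT hvy') hvy)
        · have hvD := mem_sdiff.2 ⟨hv, hvT⟩
          have : v = a := card_le_one.1 hd1.le v hvD a ha
          exact hay (this ▸ hvy)
    rw [hYe, hd1, hm4] at hY
    simp at hY
  · push Not at hE
    obtain ⟨c, hcT, hc⟩ : ∃ w ∈ T, r w y ∨ r y w := by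
      rcases h.comparable_or_bot (by omega) with h1 | ⟨a, ha, h1⟩
      · exact h1
      · exact absurd (hE a ha) h1
    obtain ⟨a, ha⟩ := card_pos.1 h.pos
    -- With fewer than l elements above it, y is never the bottom of a copy.
    have hU : #{u ∈ S | r y u} < l := by
      by_contra hcon
      have h2 := h.card_le_two ha (F := ({u ∈ S | r y u} : Finset α).powersetCard (l - 2))
        (fun B hB => by
          rw [mem_powersetCard] at hB
          exact ⟨fun b hb => h.above_subset (mem_filter.1 (hB.1 hb)).1 (mem_filter.1 (hB.1 hb)).2,
            by omega⟩)
        (fun B hB => by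
          rw [mem_powersetCard] at hB
          obtain ⟨b, hb⟩ : B.Nonempty := card_pos.1 (by omega)
          exact Or.inr ⟨b, hb, Or.inr (mem_filter.1 (hB.1 hb)).2⟩)
      rw [card_powersetCard] at h2
      have := le_choose (n := #{u ∈ S | r y u}) (k := l - 2) (by omega) (by omega)
      omega
    have hcy : c ≠ y := by
      rintro rfl
      rcases hc with hc | hc <;> exact irrefl_of r c hc
    -- Copies through y have their antichain in T and avoid c. This loses |D|·C(|T| - 2, l - 2) ≥ 2
    -- copies, with D = S \ T, whereas exactly one is missing.
    have hYle : (copies r l S \ copies r l (S.erase y)).card ≤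
        ((S \ T) ×ˢ ((T.erase y).erase c).powersetCard (l - 1)).card := by
      refine card_le_card_of_injOn (fun p => (p.1, p.2.erase y)) ?_ ?_
      · rintro ⟨v, A⟩ hA
        rw [mem_coe, mem_copies_sdiff, mem_copies] at hA
        obtain ⟨⟨hv, hAS, hAc, h3, h4⟩, hyA⟩ := hA
        replace hyA : y ∈ A := by
          refine hyA.resolve_left ?_
          rintro rfl
          have := card_le_card (fun b hb => mem_filter.2 ⟨hAS hb, h3 b hb⟩ :
            A ⊆ {u ∈ S | r v u})
          omega
        have hAT : A ⊆ T := by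
          intro b hb
          by_contra hbT
          exact h4 b hb y hyA (hE b (mem_sdiff.2 ⟨hAS hb, hbT⟩))
        refine mem_coe.2 (mem_product.2 ⟨mem_sdiff.2 ⟨hv, fun hvT => ?_⟩,
          mem_powersetCard.2 ⟨fun b hb => ?_, ?_⟩⟩)
        · obtain ⟨b, hb, hby⟩ := exists_mem_ne (by omega : 1 < A.card) y
          have hvy : v ≠ y := fun e => irrefl_of r v (h3 v (by rwa [e]))
          exact h.antichain v hvT b (hAT hb) hvy hby (h3 b hb)
        · obtain ⟨hby, hb⟩ := mem_erase.1 hb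
          refine mem_erase.2 ⟨?_, mem_erase.2 ⟨hby, hAT hb⟩⟩
          rintro rfl
          rcases hc with hc | hc
          · exact h4 b hb y hyA hc
          · exact h4 y hyA b hb hc
        · simp only
          rw [card_erase_of_mem hyA, hAc]
      · rintro ⟨v, A⟩ hA ⟨w, B⟩ hB e
        have key : ∀ v A, (v, A) ∈ copies r l S \ copies r l (S.erase y) → y ∈ A := by
          intro v A hA
          rw [mem_copies_sdiff, mem_copies] at hA
          obtain ⟨⟨hv, hAS, hAc, h3, h4⟩, hyA⟩ := hA
          refine hyA.resolve_left ?_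
          rintro rfl
          have := card_le_card (fun b hb => mem_filter.2 ⟨hAS hb, h3 b hb⟩ :
            A ⊆ {u ∈ S | r v u})
          omega
        simp only [Prod.mk.injEq] at e
        rw [e.1, ← insert_erase (key v A hA), e.2, insert_erase (key w B hB)]
    rw [card_product, card_powersetCard,
      card_erase_of_mem (mem_erase.2 ⟨hcy, hcT⟩), card_erase_of_mem h.y_mem] at hYle
    have h5 : (T.card - 1).choose (l - 1) =
        (T.card - 2).choose (l - 2) + (T.card - 2).choose (l - 1) := by
      rw [show T.card - 1 = T.card - 2 + 1 by omega, show l - 1 = l - 2 + 1 by omega,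
        Nat.choose_succ_succ']
    rw [show T.card - 1 - 1 = T.card - 2 by omega] at hYle
    rw [h5, mul_add] at hY
    have h6 := h.pos
    have h7 : 2 ≤ (T.card - 2).choose (l - 2) := by omega
    nlinarith

/-- When `y` lies above part of `T`, there are too few copies through `y`. -/
theorem card_eq_one_of_gt [IsStrictOrder α r] (h : NearTop r 2 S T x y) {w : α} (hw : w ∈ T)
    (hwy : r w y) :
    (S \ T).card = 1 := by
  have hY := h.card_copies_sdiff le_rfl
  have hwy' : w ≠ y := fun e => irrefl_of r y (by rwa [e] at hwy)
  have hE : ∀ a ∈ S \ T, r a y := fun a ha => trans_of r (h.lt a ha w hw hwy') hwy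
  -- At most d(m - 2) copies use y, where d = |S \ T| and m = |T|; the exact number d(m - 1) - 1
  -- then forces d = 1.
  have hYle : (copies r 2 S \ copies r 2 (S.erase y)).card ≤
      ((S \ T) ×ˢ ((T.erase y).erase w)).card := by
    refine card_le_card_of_surjOn (fun p : α × α => (p.1, ({p.2, y} : Finset α))) ?_
    rintro ⟨v, A⟩ hA
    rw [mem_coe, mem_copies_sdiff, mem_copies] at hA
    obtain ⟨⟨hv, hAS, hAc, h3, h4⟩, hyA⟩ := hA
    replace hyA : y ∈ A := by
      refine hyA.resolve_left ?_
      rintro rfl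
      obtain ⟨b, hb⟩ : A.Nonempty := card_pos.1 (by omega)
      have h5 := mem_erase.1 (mem_erase.1 (h.above_subset (hAS hb) (h3 b hb))).2
      exact h.antichain w hw b h5.2 hwy' h5.1 (trans_of r hwy (h3 b hb))
    obtain ⟨b, hb, hby⟩ := exists_mem_ne (by omega : 1 < A.card) y
    have hAb : A = {b, y} := by
      refine (eq_of_subset_of_card_le ?_ ?_).symm
      · exact insert_subset hb (singleton_subset_iff.2 hyA)
      · rw [hAc, card_pair hby]
    have hbT : b ∈ T := by
      by_contra hbT
      exact h4 b hb y hyA (hE b (mem_sdiff.2 ⟨hAS hb, hbT⟩))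
    have hvy : v ≠ y := fun e => irrefl_of r v (h3 v (by rwa [e]))
    refine ⟨(v, b), mem_coe.2 (mem_product.2 ⟨mem_sdiff.2 ⟨hv, fun hvT => ?_⟩, ?_⟩), ?_⟩
    · exact h.antichain v hvT b hbT hvy hby (h3 b hb)
    · refine mem_erase.2 ⟨fun e => h4 b hb y hyA ?_, mem_erase.2 ⟨hby, hbT⟩⟩
      rw [show b = w from e]
      exact hwy
    · simp only [hAb]
  rw [card_product, card_erase_of_mem (mem_erase.2 ⟨hwy', hw⟩), card_erase_of_mem h.y_mem] at hYle
  have h1 := h.pos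
  have h2 : 1 < T.card := h.l_le
  obtain ⟨p, hp⟩ : ∃ p, T.card = p + 2 := ⟨T.card - 2, by omega⟩
  rw [hp, Nat.choose_one_right] at hY
  rw [hp] at hYle
  simp only [show p + 2 - 1 = p + 1 by omega, Nat.add_sub_cancel] at hY hYle
  nlinarith

/-- The copies through `y` when `y` is not above any element of `T`. -/
theorem card_copies_sdiff_le [IsStrictOrder α r] (h : NearTop r 2 S T x y)
    (hT : ∀ w ∈ T, ¬ r w y) {e : ℕ}
    (he : ∀ w ∈ S \ T, #{a ∈ S \ T | r a w} ≤ e) :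
    (copies r 2 S \ copies r 2 (S.erase y)).card ≤ (#{w ∈ T | r y w}).choose 2 +
      #{a ∈ S \ T | r a y} * (T.card - 1 - #{w ∈ T | r y w}) + #{a ∈ S \ T | ¬ r a y} * e := by
  set C : Finset α := {w ∈ T | r y w} with hC
  have hCT : C ⊆ T.erase y := fun c hc => by
    rw [hC, mem_filter] at hc
    exact mem_erase.2 ⟨fun e => irrefl_of r y (by rw [e] at hc; exact hc.2), hc.1⟩
  -- Three kinds of copies: y is the bottom; y is paired with an element of T not above it; y is
  -- paired with a bottom element not below it.
  have hsub : copies r 2 S \ copies r 2 (S.erase y) ⊆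
      (C.powersetCard 2).image (fun A => (y, A)) ∪
      (({a ∈ S \ T | r a y} : Finset α) ×ˢ (T.erase y \ C)).image
        (fun p => (p.1, ({p.2, y} : Finset α))) ∪
      (({a ∈ S \ T | ¬ r a y} : Finset α).biUnion fun w => ({a ∈ S \ T | r a w} : Finset α).image
        fun a => (a, ({w, y} : Finset α))) := by
    rintro ⟨v, A⟩ hA
    rw [mem_copies_sdiff, mem_copies] at hA
    obtain ⟨⟨hv, hAS, hAc, h3, h4⟩, hyA⟩ := hA
    by_cases hvy : v = y
    · subst hvy
      refine mem_union_left _ (mem_union_left _ (mem_image.2 ⟨A, mem_powersetCard.2 ⟨?_, hAc⟩, rfl⟩))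
      intro b hb
      exact mem_filter.2 ⟨mem_of_mem_erase (mem_of_mem_erase (h.above_subset (hAS hb) (h3 b hb))),
        h3 b hb⟩
    · replace hyA := hyA.resolve_left hvy
      obtain ⟨b, hb, hby⟩ := exists_mem_ne (by omega : 1 < A.card) y
      have hAb : A = {b, y} := by
        refine (eq_of_subset_of_card_le ?_ ?_).symm
        · exact insert_subset hb (singleton_subset_iff.2 hyA)
        · rw [hAc, card_pair hby]
      have hvD : v ∈ S \ T := mem_sdiff.2 ⟨hv, fun hvT => hT v hvT (h3 y hyA)⟩
      by_cases hbT : b ∈ T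
      · refine mem_union_left _ (mem_union_right _ (mem_image.2 ⟨(v, b), mem_product.2
          ⟨mem_filter.2 ⟨hvD, h3 y hyA⟩, mem_sdiff.2 ⟨mem_erase.2 ⟨hby, hbT⟩, fun hbC => ?_⟩⟩, ?_⟩))
        · exact h4 y hyA b hb (mem_filter.1 hbC).2
        · simp only [hAb]
      · refine mem_union_right _ (mem_biUnion.2 ⟨b, mem_filter.2
          ⟨mem_sdiff.2 ⟨hAS hb, hbT⟩, h4 b hb y hyA⟩, mem_image.2 ⟨v, mem_filter.2 ⟨hvD, h3 b hb⟩, ?_⟩⟩)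
        simp only [hAb]
  refine (card_le_card hsub).trans ((card_union_le _ _).trans (Nat.add_le_add
    ((card_union_le _ _).trans (Nat.add_le_add ?_ ?_)) ?_))
  · refine card_image_le.trans ?_
    rw [card_powersetCard]
  · refine card_image_le.trans ?_
    rw [card_product, card_sdiff_of_subset hCT, card_erase_of_mem h.y_mem]
  · exact card_biUnion_le_card_mul _ _ _ fun w hw =>
      card_image_le.trans (he w (mem_filter.1 hw).1)

/-- Each such a gives a copy (a, {x, y}) that exists only after cloning. -/
theorem card_not_lt_le_two [IsStrictOrder α r] (h : NearTop r 2 S T x y) :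
    #{a ∈ S \ T | ¬ r a y} ≤ 2 := by
  refine le_trans ?_ h.few
  refine card_le_card_of_injOn (fun a => (a, {y, x})) ?_ ?_
  · intro a ha
    rw [mem_coe, mem_filter] at ha
    refine mem_coe.2 (mem_sdiff.2 ⟨insert_mem_both_clone (mem_sdiff.1 ha.1).1
      (singleton_subset_iff.2 (h.subset h.x_mem)) (h.subset h.y_mem) (mem_singleton_self x)
      (fun e => h.ne (mem_singleton.1 e).symm) (by simp) ⟨?_, ?_⟩ h.not_gt, fun hb => ?_⟩)
    · simpa using h.lt a ha.1 x h.x_mem h.ne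
    · simpa using irrefl_of r x
    · rw [mem_both, mem_copies] at hb
      exact ha.2 (hb.1.2.2.2.1 y (mem_insert_self _ _))
  · intro a _ b _ e
    exact (Prod.mk.inj e).1

theorem outcome_two [IsStrictOrder α r] (h : NearTop r 2 S T x y) : Outcome 2 S.card := by
  have hTS := h.card_eq
  have hm : 1 < T.card := h.l_le
  rcases h.pos.eq_or_lt with hd | hd
  · have h1 := h.max_eq
    have h2 := h.two_le
    rw [← hTS, ← hd] at h2
    rw [← hd, max_eq_zero (by omega : 1 ≤ 2), zero_add, one_mul] at h1
    rw [← hTS, ← hd]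
    exact outcome_of_one h2 h1
  · obtain ⟨e, he1, hed, hde, he⟩ := exists_decomposition le_rfl h.max_bot hd
    have hT : ∀ w ∈ T, ¬ r w y := fun w hw hwy => by
      have := h.card_eq_one_of_gt hw hwy
      omega
    have h1 := mul_le_of_decomposition le_rfl h.l_le hed hde h.max_eq
    have h2 := le_two_mul_of_decomposition he1 h.l_le hed hde h.max_eq
    have h3 := h.card_copies_sdiff_le hT he
    have h4 := h.card_copies_sdiff le_rfl
    have h5 := h.card_not_lt_le_two
    have h6 := card_filter_add_card_filter_not (s := S \ T) (fun a => r a y)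
    have h7 : #{w ∈ T | r y w} ≤ T.card - 2 := by
      rw [← h.card_erase_erase]
      refine card_le_card fun w hw => ?_
      rw [mem_filter] at hw
      exact h.above_subset (h.subset hw.1) hw.2
    have h8 : ¬ (#{a ∈ S \ T | ¬ r a y} = 0 ∧ #{w ∈ T | r y w} = 0) := by
      rintro ⟨h8, h9⟩
      rw [card_eq_zero, filter_eq_empty_iff] at h8 h9
      rcases h.comparable_or_bot le_rfl with ⟨w, hw, hwy⟩ | ⟨a, ha, hay⟩
      · exact hwy.elim (hT w hw) (h9 hw)
      · exact h8 ha hay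
    have h9 := two_mul_choose_two (#{w ∈ T | r y w})
    rw [Nat.choose_one_right] at h4
    generalize #{w ∈ T | r y w} = j at *
    generalize #{a ∈ S \ T | ¬ r a y} = t at *
    generalize #{a ∈ S \ T | r a y} = s at *
    obtain ⟨m, hm'⟩ : ∃ m, T.card = m + 1 := ⟨T.card - 1, by omega⟩
    rw [hm'] at h1 h2 h3 h4 h7
    simp only [Nat.add_sub_cancel] at h3 h4
    have key := excess_eq (d := (S \ T).card) (m := m + 1) (j := j) (t := t) (e := e)
      (by omega) (by omega) (by omega) (by omega) (by omega) (by omega) (by omega) (by omega)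
      (by omega) (by
        have h10 : ((S \ T).card : ℤ) - t = s := by omega
        rw [h10]
        obtain ⟨i, hi⟩ : ∃ i, m = j + i := ⟨m - j, by omega⟩
        rw [hi] at h3 h4 ⊢
        rw [Nat.add_sub_cancel_left] at h3
        push_cast
        zify at h3 h4
        linarith)
    have he' : e = 1 := by exact_mod_cast key.1
    have hm3 : T.card = 3 := by omega
    subst he'
    have hmax := h.max_eq
    rw [hm3] at hmax
    have := card_eq_five hd hde hmax
    exact Or.inr ⟨rfl, by omega, this.2⟩

theorem outcome [IsStrictOrder α r] (h : NearTop r l S T x y) (hl : 2 ≤ l) : Outcome l S.card := by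
  rcases hl.eq_or_lt with rfl | hl
  · exact h.outcome_two
  · exact (h.false_of_three_le hl).elim

end NearTop

end CloneTop

/-! ### From one copy below the maximum to a split top antichain -/

section Main

variable {α : Type u}

/-- If the top layer T of the clone contains x, this is `NearTop`. Otherwise y is outside T too:
either y is below all of T, and T is already a top for r, or y is re-cloned from some z in T not
above it. -/
theorem outcome_of_clone_max {r : α → α → Prop} [IsStrictOrder α r] {l : ℕ} {S : Finset α}
    {x y : α} (hl : 2 ≤ l) (hx : x ∈ S) (hy : y ∈ S) (hxy : x ≠ y) (h1 : ¬ r x y) (h2 : ¬ r y x)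
    (hr : cnt r l S + 1 = M l S.card) (hM : 2 ≤ M l S.card)
    (hc : cnt (clone r x y) l S = M l S.card) : Outcome l S.card := by
  have hlS : l < S.card := by
    by_contra hcon
    rw [max_eq_zero (by omega)] at hM
    omega
  obtain ⟨T, hT, hTl, hD⟩ := exists_isTop_of_max hl hc hlS
  by_cases hxT : x ∈ T
  · exact (nearTop_of_clone hl hxy h1 h2 hr hM hc hT hxT hy hTl hD).outcome hl
  have hyT : y ∉ T := fun hyT =>
    irrefl_of r x ((clone_right hxy).1 ((hT.2 y hyT x hx).2 hxT))
  have hTy : ∀ t ∈ T, t ≠ y := fun t ht e => hyT (e ▸ ht)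
  have hlt : ∀ a ∈ S, a ≠ y → ∀ t ∈ T, r a t ↔ a ∉ T := fun a ha hay t ht => by
    rw [← hT.2 t ht a ha, clone_of_ne hay (hTy t ht)]
  by_cases hyt : ∀ t ∈ T, r y t
  · refine outcome_of_isTop (by omega) hr (T := T) ⟨hT.1, fun t ht a ha => ?_⟩ (by omega)
    by_cases hay : a = y
    · subst hay
      exact ⟨fun _ => hyT, fun _ => hyt t ht⟩
    · exact hlt a ha hay t ht
  · push Not at hyt
    obtain ⟨z, hz, hyz⟩ := hyt
    have hxz : r x z := (hlt x hx hxy z hz).2 hxT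
    have hzy : ¬ r z y := fun h => h1 (trans_of r hxz h)
    have hzS := hT.1 hz
    have htop : IsTop (clone r z y) S (insert y T) := by
      refine ⟨insert_subset hy hT.1, fun t ht a ha => ?_⟩
      have key : ∀ a ∈ S, clone r z y a z ↔ a ∉ insert y T := by
        intro a ha
        by_cases hay : a = y
        · subst hay
          rw [clone_left (hTy z hz)]
          exact ⟨fun h => absurd h (irrefl_of r z), fun h => absurd (mem_insert_self _ _) h⟩
        · rw [clone_of_ne hay (hTy z hz), hlt a ha hay z hz, mem_insert]
          tauto
      rcases mem_insert.1 ht with rfl | htT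
      · rw [← key a ha]
        simp [clone, hTy z hz]
      · rw [← key a ha]
        by_cases hay : a = y
        · subst hay
          rw [clone_left (hTy t htT), clone_left (hTy z hz), hlt z hzS (hTy z hz) t htT]
          exact ⟨fun h => absurd hz h, fun h => absurd h (irrefl_of r z)⟩
        · rw [clone_of_ne hay (hTy t htT), clone_of_ne hay (hTy z hz), hlt a ha hay t htT,
            hlt a ha hay z hz]
    obtain ⟨B, hzB, hBT, hBc⟩ : ∃ B, {z} ⊆ B ∧ B ⊆ T ∧ B.card = l - 1 :=
      exists_subsuperset_card_eq (singleton_subset_iff.2 hz) (by rw [card_singleton]; omega)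
        (by omega)
    have hzB := singleton_subset_iff.1 hzB
    -- This new copy over x makes the gain positive, so cloning y from z gives at least M - 1
    -- copies. With M - 1 the clone itself has a top antichain; with M the situation is `NearTop`
    -- again.
    have hmem : (x, insert y B) ∈ both (clone r z y) l S z y \ both r l S z y := by
      refine mem_sdiff.2 ⟨insert_mem_both_clone hx (hBT.trans hT.1) hy hzB (fun h => hyT (hBT h))
        (by omega) ⟨fun b hb => (hlt x hx hxy b (hBT hb)).2 hxT, fun a ha b hb h => ?_⟩ hyz, ?_⟩
      · exact (hlt a (hT.1 (hBT ha)) (hTy a (hBT ha)) b (hBT hb)).1 h (hBT ha)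
      · intro h
        rw [mem_both, mem_copies] at h
        exact h1 (h.1.2.2.2.1 y (mem_insert_self _ _))
    have h3 := card_pos.2 ⟨_, hmem⟩
    have h4 := cnt_clone_add_cnt_clone (l := l) hzS hy (hTy z hz) hzy hyz
    have h5 := cnt_le (clone r z y) l S
    have h6 := cnt_le (clone r y z) l S
    rcases (show cnt (clone r z y) l S + 1 = M l S.card ∨ cnt (clone r z y) l S = M l S.card by
      omega) with h7 | h7
    · exact outcome_of_isTop (by omega) h7 htop (card_pos.2 ⟨y, mem_insert_self _ _⟩)
    · refine (nearTop_of_clone hl (hTy z hz) hzy hyz hr hM h7 htop (mem_insert_of_mem hz) hy ?_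
        ?_).outcome hl
      · exact hTl.trans (card_le_card (subset_insert _ _))
      · exact card_pos.2 ⟨x, mem_sdiff.2 ⟨hx, fun h => (mem_insert.1 h).elim hxy hxT⟩⟩

theorem outcome_of_cnt {r : α → α → Prop} [IsStrictOrder α r] {l : ℕ} {S : Finset α}
    (hl : 2 ≤ l) (hr : cnt r l S + 1 = M l S.card) : Outcome l S.card := by
  have hlS : l < S.card := by
    by_contra hcon
    rw [max_eq_zero (by omega)] at hr
    omega
  rcases (show M l S.card = 1 ∨ 2 ≤ M l S.card by omega) with hM | hM
  · refine Or.inl ⟨0, S.card, 0, by omega, by omega, attained_zero l 0 (by omega), ?_⟩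
    rw [hM]
    simp
  by_cases hS : Stable r l S
  · obtain ⟨T, hT, hTl, -⟩ := hS.isTop hl (by omega) (by omega)
    exact outcome_of_isTop (by omega) hr hT (by omega)
  · unfold Stable at hS
    push Not at hS
    obtain ⟨x, hx, y, hy, hxy, h1, h2, hb⟩ := hS
    have h3 : 0 < (both (clone r x y) l S x y \ both r l S x y).card := by
      rw [card_pos, sdiff_nonempty]
      exact hb
    have h4 := cnt_clone_add_cnt_clone (l := l) hx hy hxy h1 h2
    have h5 := cnt_le (clone r x y) l S
    have h6 := cnt_le (clone r y x) l S
    rcases (show cnt (clone r x y) l S = M l S.card ∨ cnt (clone r y x) l S = M l S.card by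
      omega) with h7 | h7
    · exact outcome_of_clone_max hl hx hy hxy h1 h2 hr hM h7
    · exact outcome_of_clone_max hl hy hx hxy.symm h2 h1 hr hM h7

theorem Attained.outcome {l n c : ℕ} (h : Attained l n c) (hl : 2 ≤ l) (hc : c + 1 = M l n) :
    Outcome l n := by
  obtain ⟨r, hr, rfl⟩ := h
  have := outcome_of_cnt (S := univ) (r := r) hl (by simpa using hc)
  simpa using this

end Main

end PosetPacking

namespace PosetPacking

open Finset

/-! ### Realization by layered posets and permutation posets -/

section Realize

/-- A rank function exhibiting a poset as an ordinal sum of antichains. -/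
def Ranked (P : Type u) [PartialOrder P] : Prop :=
  ∃ (k : ℕ) (ρ : P → Fin k), ∀ a b, a < b ↔ ρ a < ρ b

/-- A poset that is the intersection of two linear orders. -/
def TwoDimensional (P : Type u) [PartialOrder P] : Prop :=
  ∃ f g : P → ℕ, Function.Injective f ∧ Function.Injective g ∧
    ∀ a b, a ≤ b ↔ f a ≤ f b ∧ g a ≤ g b

theorem Ranked.isLayered {P : Type u} [PartialOrder P] [Fintype P] (h : Ranked P) :
    IsLayered P := by
  classical
  obtain ⟨k, ρ, hρ⟩ := h
  let e (i : Fin k) : {a : P // ρ a = i} ≃ Fin (Fintype.card {a : P // ρ a = i}) :=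
    Fintype.equivFin _
  let E : P ≃ (Σₗ i : Fin k, AntichainPoset (Fintype.card {a : P // ρ a = i})) :=
    ((Equiv.sigmaFiberEquiv ρ).symm.trans (Equiv.sigmaCongrRight e)).trans toLex
  refine ⟨k, _, ⟨⟨E, ?_⟩⟩⟩
  intro a b
  have hE : ∀ a, E a = toLex ⟨ρ a, e (ρ a) ⟨a, rfl⟩⟩ := fun a => rfl
  rw [hE, hE, Sigma.Lex.le_def]
  constructor
  · rintro (h | ⟨h1, h2⟩)
    · exact ((hρ a b).2 h).le
    · have key : ∀ (i j : Fin k) (hij : i = j) (ha : ρ a = i) (hb : ρ b = j),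
          (hij ▸ (e i ⟨a, ha⟩ : AntichainPoset _) : AntichainPoset _) ≤
            (e j ⟨b, hb⟩ : AntichainPoset (Fintype.card {a : P // ρ a = j})) → a = b := by
        rintro i _ rfl ha hb h
        exact congrArg Subtype.val ((e i).injective h)
      exact (key _ _ h1 rfl rfl h2).le
  · intro h
    rcases h.eq_or_lt with rfl | h
    · exact Or.inr ⟨rfl, le_rfl⟩
    · exact Or.inl ((hρ a b).1 h)

theorem exists_equiv_fin_of_injective {P : Type u} [Fintype P] {k : ℕ} (hk : Fintype.card P = k)
    {f : P → ℕ} (hf : Function.Injective f) :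
    ∃ e : P ≃ Fin k, ∀ a b, e a ≤ e b ↔ f a ≤ f b := by
  classical
  have hc : (univ.image f).card = k := by rw [card_image_of_injective _ hf, card_univ, hk]
  let o := (univ.image f).orderIsoOfFin hc
  let g : P → Fin k := fun a => o.symm ⟨f a, mem_image_of_mem f (mem_univ a)⟩
  have hg : Function.Injective g := fun a b h => hf (congrArg Subtype.val (o.symm.injective h))
  refine ⟨Equiv.ofBijective g ((Fintype.bijective_iff_injective_and_card g).2 ⟨hg, by simp [hk]⟩),
    fun a b => ?_⟩
  exact o.symm.le_iff_le

/-- One linear order supplies the positions and the other the values of the permutation. -/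
theorem TwoDimensional.exists_perm {P : Type u} [PartialOrder P] [Fintype P] {k : ℕ}
    (h : TwoDimensional P) (hk : Fintype.card P = k) :
    ∃ r : Equiv.Perm (Fin k), Nonempty (P ≃o PermPoset r) := by
  obtain ⟨f, g, hf, hg, h⟩ := h
  obtain ⟨F, hF⟩ := exists_equiv_fin_of_injective hk hf
  obtain ⟨G, hG⟩ := exists_equiv_fin_of_injective hk hg
  refine ⟨F.symm.trans G, ⟨⟨F, ?_⟩⟩⟩
  intro a b
  rw [h, ← hF, ← hG]
  change F a ≤ F b ∧ G (F.symm (F a)) ≤ G (F.symm (F b)) ↔ _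
  rw [Equiv.symm_apply_apply, Equiv.symm_apply_apply]

theorem twoDimensional_antichain (m : ℕ) : TwoDimensional (AntichainPoset m) := by
  refine ⟨fun i : Fin m => (i : ℕ), fun i : Fin m => (i.rev : ℕ), fun i j h => Fin.ext h,
    fun i j h => Fin.rev_injective (Fin.ext h), fun (i j : Fin m) => ?_⟩
  change i = j ↔ (i : ℕ) ≤ j ∧ (i.rev : ℕ) ≤ j.rev
  rw [← Fin.le_def, ← Fin.le_def, Fin.rev_le_rev]
  exact ⟨fun h => ⟨h.le, h.ge⟩, fun h => le_antisymm h.1 h.2⟩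

theorem twoDimensional_permPoset {k : ℕ} (r : Equiv.Perm (Fin k)) :
    TwoDimensional (PermPoset r) :=
  ⟨fun i : Fin k => (i : ℕ), fun i : Fin k => (r i : ℕ), fun _ _ h => Fin.ext h,
    fun _ _ h => r.injective (Fin.ext h), fun _ _ => Iff.rfl⟩

/-- Two functions to `ℕ`, the second shifted above the first. -/
theorem exists_sum_map {P : Type u} {Q : Type v} [Fintype P] (f : P → ℕ) (g : Q → ℕ)
    (hf : Function.Injective f) (hg : Function.Injective g) :
    ∃ F : P ⊕ₗ Q → ℕ, Function.Injective F ∧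
      (∀ a b, F (Sum.inlₗ a) ≤ F (Sum.inlₗ b) ↔ f a ≤ f b) ∧
      (∀ a b, F (Sum.inrₗ a) ≤ F (Sum.inrₗ b) ↔ g a ≤ g b) ∧
      ∀ a b, F (Sum.inlₗ a) < F (Sum.inrₗ b) := by
  classical
  obtain ⟨N, hN⟩ : ∃ N, ∀ a, f a < N :=
    ⟨univ.sup f + 1, fun a => Nat.lt_succ_of_le (le_sup (mem_univ a))⟩
  refine ⟨fun x => Sum.elim f (fun b => N + g b) (ofLex x), ?_, fun a b => Iff.rfl,
    fun a b => Nat.add_le_add_iff_left, fun a b => (hN a).trans_le (Nat.le_add_right _ _)⟩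
  exact (Function.Injective.sumElim hf (fun a b h => hg (Nat.add_left_cancel h))
    (fun a b => ((hN a).trans_le (Nat.le_add_right _ _)).ne)).comp ofLex.injective

theorem TwoDimensional.sum {P : Type u} {Q : Type v} [PartialOrder P] [PartialOrder Q] [Fintype P]
    (hP : TwoDimensional P) (hQ : TwoDimensional Q) : TwoDimensional (P ⊕ₗ Q) := by
  obtain ⟨f, g, hf, hg, h⟩ := hP
  obtain ⟨f', g', hf', hg', h'⟩ := hQ
  obtain ⟨F, hF, F1, F2, F3⟩ := exists_sum_map f f' hf hf'
  obtain ⟨G, hG, G1, G2, G3⟩ := exists_sum_map g g' hg hg'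
  refine ⟨F, G, hF, hG, ?_⟩
  rintro (a | a) (b | b)
  · exact Sum.Lex.inl_le_inl_iff.trans ((h a b).trans (and_congr (F1 a b) (G1 a b)).symm)
  · exact ⟨fun _ => ⟨(F3 a b).le, (G3 a b).le⟩, fun _ => Sum.Lex.inl_le_inr a b⟩
  · exact ⟨fun h => absurd h Sum.Lex.not_inr_le_inl, fun h => absurd h.1 (F3 b a).not_ge⟩
  · exact Sum.Lex.inr_le_inr_iff.trans ((h' a b).trans (and_congr (F2 a b) (G2 a b)).symm)

theorem Ranked.sum_antichain {P : Type u} [PartialOrder P] (h : Ranked P) (m : ℕ) :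
    Ranked (P ⊕ₗ AntichainPoset m) := by
  obtain ⟨k, ρ, hρ⟩ := h
  refine ⟨k + 1, fun x => Sum.elim (fun a => (ρ a).castSucc) (fun _ => Fin.last k) (ofLex x), ?_⟩
  rintro (a | a) (b | b)
  · exact Sum.Lex.inl_lt_inl_iff.trans ((hρ a b).trans Fin.castSucc_lt_castSucc_iff.symm)
  · exact ⟨fun _ => Fin.castSucc_lt_last _, fun _ => Sum.Lex.inl_lt_inr a b⟩
  · exact ⟨fun h => absurd h Sum.Lex.not_inr_lt_inl,
      fun h => absurd h (Fin.castSucc_lt_last (ρ b)).not_gt⟩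
  · exact Sum.Lex.inr_lt_inr_iff.trans
      ⟨fun h => absurd h (antichain_not_lt a b), fun h => absurd h (lt_irrefl _)⟩

theorem ranked_of_isEmpty (P : Type u) [PartialOrder P] [IsEmpty P] : Ranked P :=
  ⟨0, isEmptyElim, isEmptyElim⟩

theorem Ranked.isEmpty_sum {P : Type u} {Q : Type v} [PartialOrder P] [PartialOrder Q] [IsEmpty P]
    (h : Ranked Q) : Ranked (P ⊕ₗ Q) := by
  obtain ⟨k, ρ, hρ⟩ := h
  refine ⟨k, fun x => Sum.elim isEmptyElim ρ (ofLex x), ?_⟩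
  rintro (a | a) (b | b)
  · exact isEmptyElim a
  · exact isEmptyElim a
  · exact isEmptyElim b
  · exact Sum.Lex.inr_lt_inr_iff.trans (hρ a b)

theorem card_sum_lex (P : Type u) (Q : Type v) [Fintype P] [Fintype Q] :
    Fintype.card (P ⊕ₗ Q) = Fintype.card P + Fintype.card Q :=
  (Fintype.card_congr ofLex).trans Fintype.card_sum

theorem card_antichain (m : ℕ) : Fintype.card (AntichainPoset m) = m := Fintype.card_fin m

theorem copyCount_sum_antichain {l : ℕ} (hl : 1 ≤ l) (P : Type u) [PartialOrder P] [Fintype P]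
    (m : ℕ) : copyCount (PatternQ l) (P ⊕ₗ AntichainPoset m) =
      copyCount (PatternQ l) P + Fintype.card P * m.choose l := by
  let eP : P ↪ P ⊕ₗ AntichainPoset m := ⟨Sum.inlₗ, fun a b h => by simpa using h⟩
  let eA : AntichainPoset m ↪ P ⊕ₗ AntichainPoset m := ⟨Sum.inrₗ, fun a b h => by simpa using h⟩
  have hT : IsTop (α := P ⊕ₗ AntichainPoset m) (· < ·) univ (univ.map eA) := by
    refine ⟨subset_univ _, fun t ht a _ => ?_⟩
    obtain ⟨i, -, rfl⟩ := mem_map.1 ht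
    rcases a with a | a
    · refine ⟨fun _ h => ?_, fun _ => Sum.Lex.inl_lt_inr a i⟩
      obtain ⟨j, -, hj⟩ := mem_map.1 h
      exact Sum.inr_ne_inl (toLex.injective hj)
    · exact ⟨fun h => absurd (Sum.Lex.inr_lt_inr_iff.1 h) (antichain_not_lt a i),
        fun h => absurd (mem_map_of_mem eA (mem_univ a)) h⟩
  have hD : ∀ _i : DecidableEq (P ⊕ₗ AntichainPoset m), univ \ univ.map eA = univ.map eP := by
    intro _i
    ext a
    rw [mem_sdiff, mem_map, mem_map]
    rcases a with a | a
    · refine ⟨fun _ => ⟨a, mem_univ _, rfl⟩, fun _ => ⟨mem_univ _, ?_⟩⟩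
      rintro ⟨j, -, hj⟩
      exact Sum.inr_ne_inl (toLex.injective hj)
    · refine ⟨fun h => absurd ⟨a, mem_univ _, rfl⟩ h.2, ?_⟩
      rintro ⟨j, -, hj⟩
      exact absurd (toLex.injective hj) Sum.inl_ne_inr
  rw [copyCount_eq_cnt, hT.cnt_eq hl, hD, ← cnt_map, card_map, card_map, card_univ, card_univ,
    card_antichain, copyCount_eq_cnt]
  congr 1
  exact cnt_congr fun a _ b _ => Sum.Lex.inl_lt_inl_iff

/-- `Q₁ ⊕ Q₂` has `n` elements and `c` copies, with `Q₂` layered, and `Q₁` empty unless `l = 2`. -/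
def Realized (l n c : ℕ) : Prop :=
  ∃ (Q₁ Q₂ : Type) (_ : PartialOrder Q₁) (_ : PartialOrder Q₂) (_ : Fintype Q₁) (_ : Fintype Q₂),
    Fintype.card Q₁ + Fintype.card Q₂ = n ∧ copyCount (PatternQ l) (Q₁ ⊕ₗ Q₂) = c ∧
    TwoDimensional Q₁ ∧ TwoDimensional Q₂ ∧ Ranked Q₂ ∧
    Fintype.card Q₁ ≤ 5 ∧ (2 < l → IsEmpty Q₁)

theorem Realized.add_top {l n c : ℕ} (h : Realized l n c) (hl : 1 ≤ l) (m : ℕ) :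
    Realized l (n + m) (c + n * m.choose l) := by
  obtain ⟨Q₁, Q₂, _, _, _, _, hn, hc, h1, h2, h3, h4, h5⟩ := h
  refine ⟨Q₁, Q₂ ⊕ₗ AntichainPoset m, inferInstance, inferInstance, inferInstance, inferInstance,
    ?_, ?_, h1, h2.sum (twoDimensional_antichain m), h3.sum_antichain m, h4, h5⟩
  · rw [card_sum_lex, card_antichain, ← hn, add_assoc]
  · rw [← copyCount_congr (PatternQ l) (OrderIso.sumLexAssoc Q₁ Q₂ (AntichainPoset m)),
      copyCount_sum_antichain hl, hc, card_sum_lex, hn]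

instance : IsEmpty (AntichainPoset 0) := inferInstanceAs (IsEmpty (Fin 0))

theorem realized_zero (l : ℕ) : Realized l 0 0 := by
  refine ⟨AntichainPoset 0, AntichainPoset 0, inferInstance, inferInstance, inferInstance,
    inferInstance, rfl, ?_, twoDimensional_antichain 0, twoDimensional_antichain 0,
    ranked_of_isEmpty _, Nat.zero_le 5, fun _ => inferInstance⟩
  rw [copyCount_eq_cnt]
  refine cnt_eq_zero_of_card_le ?_
  rw [card_univ, card_sum_lex]
  exact Nat.zero_le l

theorem realized_max {l : ℕ} (hl : 2 ≤ l) (n : ℕ) : Realized l n (M l n) := by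
  induction n using Nat.strong_induction_on with
  | _ n ih =>
    rcases le_or_gt n l with h | h
    · have := (realized_zero l).add_top (by omega) n
      rw [max_eq_zero h]
      simpa using this
    · obtain ⟨d, m, hd, rfl, hM⟩ := exists_max_eq hl h
      rw [hM]
      exact (ih d hd).add_top (by omega) m

/-- The permutation `15423`. -/
def perm15423 : Equiv.Perm (Fin 5) :=
  ⟨![0, 4, 3, 1, 2], ![0, 3, 4, 2, 1], by decide, by decide⟩

/-- The entry 1 lies below the other four, whose only comparable pair is 2 < 3, so 6 - 1 pairs
count; no other entry has two entries above it. -/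
theorem copyCount_perm15423 : copyCount (PatternQ 2) (PermPoset perm15423) = 5 := by
  have h : cnt (α := Fin 5) (fun i j => i < j ∧ perm15423 i < perm15423 j) 2 univ = 5 := by
    have : ((univ ×ˢ powersetCard 2 univ : Finset (Fin 5 × Finset (Fin 5))).filter fun p =>
        (∀ a ∈ p.2, p.1 < a ∧ perm15423 p.1 < perm15423 a) ∧
          ∀ a ∈ p.2, ∀ b ∈ p.2, ¬ (a < b ∧ perm15423 a < perm15423 b)).card = 5 := by
      decide
    refine Eq.trans (congrArg card ?_) this
    unfold copies IsCopy
    congr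
  refine (copyCount_eq_cnt 2 _).trans (Eq.trans ?_ h)
  refine cnt_congr (α := Fin 5) fun i _ j _ => ?_
  change (i ≤ j ∧ perm15423 i ≤ perm15423 j) ∧ ¬ (j ≤ i ∧ perm15423 j ≤ perm15423 i) ↔ _
  have hi : perm15423 i = perm15423 j ↔ i = j := perm15423.injective.eq_iff
  constructor
  · rintro ⟨⟨h1, h2⟩, h3⟩
    have hne : i ≠ j := fun e => h3 ⟨e.ge, (hi.2 e).ge⟩
    exact ⟨lt_of_le_of_ne h1 hne, lt_of_le_of_ne h2 (fun e => hne (hi.1 e))⟩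
  · rintro ⟨h1, h2⟩
    exact ⟨⟨h1.le, h2.le⟩, fun h => absurd h.1 h1.not_ge⟩

theorem realized_five : Realized 2 5 5 := by
  refine ⟨PermPoset perm15423, AntichainPoset 0, inferInstance, inferInstance, inferInstance,
    inferInstance, rfl, ?_, twoDimensional_permPoset _, twoDimensional_antichain 0,
    ranked_of_isEmpty _, le_of_eq rfl, fun h => absurd h (lt_irrefl 2)⟩
  rw [copyCount_sum_antichain (by omega), copyCount_perm15423]
  simp

/-- The bottom misses its own maximum by at most one, since a larger deficit would persist under the
top antichain. So it is replaced by a layered maximum or by induction. -/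
theorem realized_of_outcome {l n : ℕ} (hl : 2 ≤ l)
    (ih : ∀ d < n, ∀ c, Attained l d c → c + 1 = M l d → Realized l d c) (h : Outcome l n) :
    (∃ d m c, 0 < m ∧ d + m = n ∧ Realized l d c ∧ c + d * m.choose l + 1 = M l n) ∨
      (l = 2 ∧ n = 5 ∧ M 2 5 = 6) := by
  refine h.imp_left ?_
  rintro ⟨d, m, c, hm, hdm, hc, hM⟩
  refine ⟨d, m, c, hm, hdm, ?_, hM⟩
  have h1 := hc.le
  have h2 := max_add_le (l := l) (by omega) d m
  rw [hdm] at h2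
  rcases (show c = M l d ∨ c + 1 = M l d by omega) with rfl | h3
  · exact realized_max hl d
  · exact ih d (by omega) c hc h3

theorem Attained.realized {l : ℕ} (hl : 2 ≤ l) (n c : ℕ) (h : Attained l n c)
    (hc : c + 1 = M l n) : Realized l n c := by
  induction n using Nat.strong_induction_on generalizing c with
  | _ n ih =>
    rcases realized_of_outcome hl ih (h.outcome hl hc) with
      ⟨d, m, c', hm, rfl, hr, hM⟩ | ⟨rfl, rfl, hM⟩
    · have := hr.add_top (by omega) m
      rwa [show c' + d * m.choose l = c by omega] at this
    · rw [show c = 5 by omega]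
      exact realized_five

end Realize

end PosetPacking

/-! ### Assembly of the theorem -/

open PosetPacking in
theorem mainTheorem8 (l n : ℕ) (hl : 2 ≤ l)
    (P : Type u) [PartialOrder P] [Fintype P] (hn : Fintype.card P = n)
    (hP : (copyCount (PatternQ l) P : ℤ) = (maxCopyCount n (PatternQ l) : ℤ) - 1) :
    ∃ (Q : Type) (_ : PartialOrder Q) (_ : Fintype Q),
      Fintype.card Q = n ∧
      (copyCount (PatternQ l) Q : ℤ) = (maxCopyCount n (PatternQ l) : ℤ) - 1 ∧
      (2 < l → IsLayered Q) ∧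
      (l = 2 →
        ∃ (Q₁ Q₂ : Type) (_ : PartialOrder Q₁) (_ : PartialOrder Q₂)
          (_ : Fintype Q₁) (_ : Fintype Q₂),
          Fintype.card Q₁ ≤ 5 ∧ IsLayered Q₂ ∧ Nonempty (Q ≃o Q₁ ⊕ₗ Q₂)) ∧
      ∃ (k m : ℕ) (r : Equiv.Perm (Fin k)),
        k + m = n ∧
        (¬ (l = 2 ∧ n = 5) → 0 < m) ∧
        Nonempty (Q ≃o PermPoset r ⊕ₗ AntichainPoset m) := by
  have hA : Attained l n (copyCount (PatternQ l) P) := by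
    have := attained_cnt (α := P) (· < ·) l Finset.univ
    rwa [Finset.card_univ, hn, ← copyCount_eq_cnt] at this
  have hc : copyCount (PatternQ l) P + 1 = M l n := by
    have : (M l n : ℤ) = maxCopyCount n (PatternQ l) := rfl
    omega
  -- The last splitting is kept explicit, rather than using `Attained.realized` for n itself,
  -- because its nonempty top antichain is the required `𝒜_m`.
  rcases realized_of_outcome hl (fun d _ c => Attained.realized hl d c) (hA.outcome hl hc) with
    ⟨d, m, c, hm, hdm, hr, hM⟩ | ⟨rfl, rfl, hM⟩
  · obtain ⟨Q₁, Q₂, _, _, _, _, hd, hcQ, h1, h2, h3, h4, h5⟩ := hr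
    have hcard : Fintype.card (Q₁ ⊕ₗ Q₂) = d := by rw [card_sum_lex, hd]
    obtain ⟨r, ⟨e⟩⟩ := (h1.sum h2).exists_perm hcard
    refine ⟨(Q₁ ⊕ₗ Q₂) ⊕ₗ AntichainPoset m, inferInstance, inferInstance, ?_, ?_, fun hl2 => ?_,
      fun _ => ?_, d, m, r, hdm, fun _ => hm, ⟨e.sumLexCongr (OrderIso.refl _)⟩⟩
    · rw [card_sum_lex, hcard, card_antichain, hdm]
    · rw [copyCount_sum_antichain (by omega), hcQ, hcard]
      have : (M l n : ℤ) = maxCopyCount n (PatternQ l) := rfl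
      omega
    · have := h5 hl2
      exact (h3.isEmpty_sum.sum_antichain m).isLayered
    · exact ⟨Q₁, Q₂ ⊕ₗ AntichainPoset m, inferInstance, inferInstance, inferInstance,
        inferInstance, h4, (h3.sum_antichain m).isLayered, ⟨OrderIso.sumLexAssoc _ _ _⟩⟩
  · refine ⟨PermPoset perm15423 ⊕ₗ AntichainPoset 0, inferInstance, inferInstance, rfl, ?_,
      fun h => absurd h (lt_irrefl 2), fun _ => ?_, 5, 0, perm15423, rfl,
      fun h => absurd ⟨rfl, rfl⟩ h, ⟨OrderIso.refl _⟩⟩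
    · rw [copyCount_sum_antichain (by omega), copyCount_perm15423]
      have : (M 2 5 : ℤ) = maxCopyCount 5 (PatternQ 2) := rfl
      simp
      omega
    · exact ⟨PermPoset perm15423, AntichainPoset 0, inferInstance, inferInstance, inferInstance,
        inferInstance, le_of_eq rfl, (ranked_of_isEmpty _).isLayered, ⟨OrderIso.refl _⟩⟩
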